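/- Let $p$ be a prime. For a finite family $x=(x_0,x_1,\ldots)$ in a ring put $w_i(x)=\sum_{k=0}^{i}p^kx_k^{p^{i-k}}$, and write $[u,v]=uv-vu$. For $m,n\ge 0$ let $B_{m,n}(\mathbb Q)$ be the associative unital $\mathbb Q$-algebra generated by $x_0,\ldots,x_{m-1},y_0,\ldots,y_{n-1}$ with the relations $[w_i(x),w_j(x)]=0$, $[w_i(y),w_j(y)]=0$ and $[w_j(y),w_i(x)]=\delta_{i,j}p^i$. For $i,j\ge 0$ let $c_{i,j}\in\mathbb Z[X_0,\ldots,X_{i-1}][Y_0,\ldots,Y_{j-1}]$ be the unique polynomial with integer coefficients such that $[y_j,x_i]=c_{i,j}(x_0,\ldots,x_{i-1},y_0,\ldots,y_{j-1})$ in $B_{i+1,j+1}(\mathbb Q)$; here and below polynomials are evaluated in normal order, all $x$'s to the left of all $y$'s. For a commutative ring $R$ let $B_{m,n}(R)$ be the associative unital $R$-algebra generated by $x_0,\ldots,x_{m-1},y_0,\ldots,y_{n-1}$ with the relations $[x_i,x_j]=0$, $[y_i,y_j]=0$ and $[y_j,x_i]=c_{i,j}(x_0,\ldots,x_{i-1},y_0,\ldots,y_{j-1})$.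 **Theorem.** Let $K$ be a field of characteristic $p$, let $m,n\ge 0$, and let $a=(a_0,\ldots,a_{m-1})\in W_m(K)$ and $b=(b_0,\ldots,b_{n-1})\in W_n(K)$ be truncated $p$-typical Witt vectors. Let $$A_{((a,b))}=B_{m,n}(K)/(F^nx-a,\;F^my-b)=B_{m,n}(K)/(x_i^{p^n}-a_i,\;y_j^{p^m}-b_j\mid 0\le i<m,\,0\le j<n).$$ Then $A_{((a,b))}$ is a central simple $K$-algebra of degree $p^{mn}$, i.e. it is a simple ring with centre $K$ and $\dim_KA_{((a,b))}=p^{2mn}$. Moreover the monomials $x_0^{i_0}\cdots x_{m-1}^{i_{m-1}}y_0^{j_0}\cdots y_{n-1}^{j_{n-1}}$ with $0\le i_q<p^n$ and $0\le j_r<p^m$ form a $K$-basis of $A_{((a,b))}$. -/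

import Mathlib

/-- The ghost component `w_i(x) = ∑_{k ≤ i} p^k x_k^{p^{i-k}}` of a finite family `x` in a
(not necessarily commutative) ring. -/
def ghostComp {A : Type*} [Ring A] {m : ℕ} (p : ℕ) (x : Fin m → A) (i : Fin m) : A :=
  ∑ k : Fin m, if k ≤ i then (p : A) ^ (k : ℕ) * x k ^ p ^ ((i : ℕ) - (k : ℕ)) else 0

/-- The ordered monomial `x_0^{i_0} ⋯ x_{m-1}^{i_{m-1}} y_0^{j_0} ⋯ y_{n-1}^{j_{n-1}}`. -/
def normalMonomial {A : Type*} [Ring A] {m n : ℕ} (x : Fin m → A) (y : Fin n → A)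
    (i : Fin m → ℕ) (j : Fin n → ℕ) : A :=
  (List.ofFn fun q => x q ^ i q).prod * (List.ofFn fun r => y r ^ j r).prod

/-- The normally ordered value `c(x, y) = ∑ a_{i,j} x^i y^j` of a polynomial
`c = ∑ a_{i,j} X^i Y^j` with integer coefficients: all the `x`'s stand to the left of all
the `y`'s. -/
noncomputable def normalEval {A : Type*} [Ring A] {m n : ℕ}
    (c : MvPolynomial (Fin m ⊕ Fin n) ℤ) (x : Fin m → A) (y : Fin n → A) : A :=
  ∑ e ∈ c.support,
    ((c.coeff e : ℤ) : A) * normalMonomial x y (fun q => e (Sum.inl q)) (fun r => e (Sum.inr r))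

/-- The generators `x_0, …, x_{m-1}` of the free algebra. -/
def freeX (R : Type*) [CommRing R] (m n : ℕ) (i : Fin m) : FreeAlgebra R (Fin m ⊕ Fin n) :=
  FreeAlgebra.ι R (Sum.inl i)

/-- The generators `y_0, …, y_{n-1}` of the free algebra. -/
def freeY (R : Type*) [CommRing R] (m n : ℕ) (j : Fin n) : FreeAlgebra R (Fin m ⊕ Fin n) :=
  FreeAlgebra.ι R (Sum.inr j)

/-- The defining relations of the rational `p`-typical algebra `B_{m,n}(ℚ)`:
`[w_i(x), w_j(x)] = 0`, `[w_i(y), w_j(y)] = 0` and `[w_j(y), w_i(x)] = δ_{i,j} p^i`. -/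
inductive RatBRel (p m n : ℕ) :
    FreeAlgebra ℚ (Fin m ⊕ Fin n) → FreeAlgebra ℚ (Fin m ⊕ Fin n) → Prop
  | xx (i j : Fin m) : RatBRel p m n
      (ghostComp p (freeX ℚ m n) i * ghostComp p (freeX ℚ m n) j)
      (ghostComp p (freeX ℚ m n) j * ghostComp p (freeX ℚ m n) i)
  | yy (i j : Fin n) : RatBRel p m n
      (ghostComp p (freeY ℚ m n) i * ghostComp p (freeY ℚ m n) j)
      (ghostComp p (freeY ℚ m n) j * ghostComp p (freeY ℚ m n) i)
  | yx (i : Fin m) (j : Fin n) : RatBRel p m n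
      (ghostComp p (freeY ℚ m n) j * ghostComp p (freeX ℚ m n) i
        - ghostComp p (freeX ℚ m n) i * ghostComp p (freeY ℚ m n) j)
      (if (i : ℕ) = (j : ℕ) then (p : FreeAlgebra ℚ (Fin m ⊕ Fin n)) ^ (i : ℕ) else 0)

/-- The rational `p`-typical algebra `B_{m,n}(ℚ)`. -/
abbrev RatB (p m n : ℕ) : Type := RingQuot (RatBRel p m n)

/-- The generators `x_i` of `B_{m,n}(ℚ)`. -/
noncomputable def ratX (p m n : ℕ) (i : Fin m) : RatB p m n :=
  RingQuot.mkAlgHom ℚ (RatBRel p m n) (freeX ℚ m n i)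

/-- The generators `y_j` of `B_{m,n}(ℚ)`. -/
noncomputable def ratY (p m n : ℕ) (j : Fin n) : RatB p m n :=
  RingQuot.mkAlgHom ℚ (RatBRel p m n) (freeY ℚ m n j)

/-- `c ∈ ℤ[X_0, …, X_{i-1}][Y_0, …, Y_{j-1}]` expresses the commutator of the last generators of
`B_{i+1,j+1}(ℚ)`: one has `[y_j, x_i] = c(x_0, …, x_{i-1}, y_0, …, y_{j-1})` there. -/
def IsCommutatorPoly (p i j : ℕ) (c : MvPolynomial (Fin i ⊕ Fin j) ℤ) : Prop :=
  ratY p (i + 1) (j + 1) (Fin.last j) * ratX p (i + 1) (j + 1) (Fin.last i)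
      - ratX p (i + 1) (j + 1) (Fin.last i) * ratY p (i + 1) (j + 1) (Fin.last j)
    = normalEval c (fun q => ratX p (i + 1) (j + 1) q.castSucc)
        (fun r => ratY p (i + 1) (j + 1) r.castSucc)

/-- The integral polynomial `c_{i,j}`: the one with `[y_j, x_i] = c_{i,j}(x, y)` over `ℚ`. For
prime `p` exactly one polynomial has this property, so nothing depends on the choice. -/
noncomputable def commutatorPoly (p i j : ℕ) : MvPolynomial (Fin i ⊕ Fin j) ℤ :=
  Classical.epsilon (IsCommutatorPoly p i j)

/-- The defining relations of the `p`-typical algebra `B_{m,n}(R)` over any commutative ring `R`: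
`[x_i, x_j] = 0`, `[y_i, y_j] = 0` and
`[y_j, x_i] = c_{i,j}(x_0, …, x_{i-1}, y_0, …, y_{j-1})`. -/
inductive BRel (p : ℕ) (R : Type*) [CommRing R] (m n : ℕ) :
    FreeAlgebra R (Fin m ⊕ Fin n) → FreeAlgebra R (Fin m ⊕ Fin n) → Prop
  | xx (i j : Fin m) : BRel p R m n
      (freeX R m n i * freeX R m n j) (freeX R m n j * freeX R m n i)
  | yy (i j : Fin n) : BRel p R m n
      (freeY R m n i * freeY R m n j) (freeY R m n j * freeY R m n i)
  | yx (i : Fin m) (j : Fin n) : BRel p R m n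
      (freeY R m n j * freeX R m n i - freeX R m n i * freeY R m n j)
      (normalEval (commutatorPoly p i j)
        (fun q : Fin i => freeX R m n (q.castLE i.isLt.le))
        (fun r : Fin j => freeY R m n (r.castLE j.isLt.le)))

/-- The `p`-typical algebra `B_{m,n}(R)`. -/
abbrev BAlg (p : ℕ) (R : Type*) [CommRing R] (m n : ℕ) : Type _ := RingQuot (BRel p R m n)

/-- The generators `x_i` of `B_{m,n}(R)`. -/
noncomputable def bX (p : ℕ) (R : Type*) [CommRing R] (m n : ℕ) (i : Fin m) : BAlg p R m n :=
  RingQuot.mkAlgHom R (BRel p R m n) (freeX R m n i)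

/-- The generators `y_j` of `B_{m,n}(R)`. -/
noncomputable def bY (p : ℕ) (R : Type*) [CommRing R] (m n : ℕ) (j : Fin n) : BAlg p R m n :=
  RingQuot.mkAlgHom R (BRel p R m n) (freeY R m n j)

/-- The relations `F^n x = a`, `F^m y = b` between Witt vectors of lengths `m` and `n`. In
characteristic `p` the Frobenius raises every entry to the power `p`, so that entrywise they read
`x_i^{p^n} = a_i` and `y_j^{p^m} = b_j`. -/
inductive SymbolRel (p : ℕ) {K : Type*} [Field K] {m n : ℕ}
    (a : TruncatedWittVector p m K) (b : TruncatedWittVector p n K) :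
    BAlg p K m n → BAlg p K m n → Prop
  | x (i : Fin m) : SymbolRel p a b
      (bX p K m n i ^ p ^ n) (algebraMap K (BAlg p K m n) (TruncatedWittVector.coeff i a))
  | y (j : Fin n) : SymbolRel p a b
      (bY p K m n j ^ p ^ m) (algebraMap K (BAlg p K m n) (TruncatedWittVector.coeff j b))

/-- The algebra `A_{((a,b))} = B_{m,n}(K) / (F^n x - a, F^m y - b)`. -/
abbrev SymbolAlg (p : ℕ) {K : Type*} [Field K] {m n : ℕ}
    (a : TruncatedWittVector p m K) (b : TruncatedWittVector p n K) : Type _ :=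
  RingQuot (SymbolRel p a b)

/-- The image of `x_i` in `A_{((a,b))}`. -/
noncomputable def symbolX (p : ℕ) {K : Type*} [Field K] {m n : ℕ}
    (a : TruncatedWittVector p m K) (b : TruncatedWittVector p n K) (i : Fin m) :
    SymbolAlg p a b :=
  RingQuot.mkAlgHom K (SymbolRel p a b) (bX p K m n i)

/-- The image of `y_j` in `A_{((a,b))}`. -/
noncomputable def symbolY (p : ℕ) {K : Type*} [Field K] {m n : ℕ}
    (a : TruncatedWittVector p m K) (b : TruncatedWittVector p n K) (j : Fin n) :
    SymbolAlg p a b :=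
  RingQuot.mkAlgHom K (SymbolRel p a b) (bY p K m n j)

/-! Over an algebraic closure `L` of `K` write `a_i = α_i^{p^n}` and `b_j = β_j^{p^m}`. The ordered
monomials span `A_{((a,b))}`, because `[y_j, x_i]` is normally ordered and involves only `y_r` with
`r < j`. It therefore suffices to find a representation on an `L`-space of dimension `p^{mn}` whose
image generates all endomorphisms: the `p^{2mn}` monomials then go to an `L`-basis of the
endomorphism algebra, and linear independence, centre and simplicity descend to `K`.

The space is `L[X_0, …, X_{m-1}]/(X_i^{p^n})`, with `x_i` acting as multiplication by `X_i + α_i`.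
To find the `y_j`, start in characteristic zero. The derivations `p^j ∂/∂w_j` satisfy the ghost
relations, so `y` should be a Witt vector of operators with these ghost components, plus a constant
Witt vector. Such a vector exists integrally: the translation `f(x) ↦ f(x + V^i[t])` is a power
series in `t` whose coefficients are commuting integral operators and whose logarithmic derivative
is `∑_j p^{i+j} ∂/∂w_{i+j} t^{p^j}`. The coefficients `z_{p^j}` of its Euler factorization `∏ (1 -
z_d t^d)⁻¹` form the Witt vector `opWitt i` (`ghostComponent_opWitt`). Comparing ghost components,
Frobenius maps `opWitt i` to `opWitt (i + 1)`, and `opWitt m = 0`. The same operators show that the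
commutator polynomials have integer coefficients (`exists_isCommutatorPoly`).

Modulo `p` Frobenius raises coordinates to the power `p`. Hence `y_j^{p^m} = β_j^{p^m}`, and the
coordinates of `opWitt i` are the `p^i`-th powers of those of `opWitt 0`. For `j < n` the `j`-th
coordinate uses only coefficients of `t^d` with `d < p^n`, so it is linear over the `X_l^{p^n}` and
acts on the quotient. The `j`-th coordinate of `opWitt i` acts on powers of `X_i^{p^j}` like the
derivative in this element, so a product of such operators sends `∏ X_i^{p^n - 1}` to a nonzero
constant (`exists_topExp`). Since the truncated polynomial ring is a Frobenius algebra, this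
operator and the multiplications generate all endomorphisms (`eq_top_of_topExp`). -/

/-! ### Ghost components, Frobenius and Witt coordinates -/

namespace WittVector

variable {p : ℕ} [hp : Fact p.Prime] {R : Type*} [CommRing R]

theorem ghostComponent_eq_sum (n : ℕ) (x : WittVector p R) :
    ghostComponent n x = ∑ l ∈ Finset.range (n + 1), (p : R) ^ l * x.coeff l ^ p ^ (n - l) := by
  simp [ghostComponent_apply, wittPolynomial_eq_sum_C_mul_X_pow, map_sum]

theorem ext_of_ghostComponent_eq (htf : ∀ r : R, (p : R) * r = 0 → r = 0) {x y : WittVector p R}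
    (h : ∀ n, ghostComponent n x = ghostComponent n y) : x = y := by
  have htf' : ∀ (n : ℕ) (r : R), (p : R) ^ n * r = 0 → r = 0 := by
    intro n
    induction n with
    | zero => intro r hr; simpa using hr
    | succ n ih => intro r hr; exact ih r (htf _ (by rw [← hr]; ring))
  ext n
  induction n using Nat.strong_induction_on with
  | _ n ih =>
    have hn := h n
    rw [ghostComponent_eq_sum, ghostComponent_eq_sum, Finset.sum_range_succ,
      Finset.sum_range_succ, Finset.sum_congr rfl fun l hl => by
        rw [ih l (Finset.mem_range.1 hl)]] at hn
    have := add_left_cancel hn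
    simp only [Nat.sub_self, pow_zero, pow_one] at this
    exact sub_eq_zero.1 (htf' n _ (by rw [mul_sub, this, sub_self]))

theorem ghostComponent_verschiebung_iterate (i n : ℕ) (x : WittVector p R) :
    ghostComponent n (verschiebung^[i] x) =
      if i ≤ n then (p : R) ^ i * ghostComponent (n - i) x else 0 := by
  induction i generalizing n with
  | zero => simp
  | succ i ih =>
    rw [Function.iterate_succ_apply']
    cases n with
    | zero => simp [ghostComponent_zero_verschiebung]
    | succ n =>
      rw [ghostComponent_verschiebung, ih]
      by_cases h : i ≤ n <;> simp [h, pow_succ]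
      ring

theorem dvd_coeff_frobenius_sub (x : WittVector p R) (j : ℕ) :
    (p : R) ∣ (frobenius x).coeff j - x.coeff j ^ p := by
  rw [coeff_frobenius, frobeniusPoly]
  simp

theorem dvd_coeff_frobenius_iterate_sub (i : ℕ) (x : WittVector p R) (j : ℕ) :
    (p : R) ∣ (frobenius^[i] x).coeff j - x.coeff j ^ p ^ i := by
  induction i with
  | zero => simp
  | succ i ih =>
    rw [Function.iterate_succ_apply', pow_succ, pow_mul]
    have h1 := dvd_coeff_frobenius_sub (frobenius^[i] x) j
    have h2 := ih.trans (sub_dvd_pow_sub_pow _ _ p)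
    have := dvd_add h1 h2
    rwa [sub_add_sub_cancel] at this

/-- Witt sums and differences are integral polynomials in the coordinates up to the same index. This
keeps Witt vector arithmetic inside subrings of operators. -/
theorem peval_mem {S : Subring R} {n : ℕ} {Φ : MvPolynomial (Fin 2 × ℕ) ℤ}
    (hΦ : Φ.vars ⊆ Finset.univ ×ˢ Finset.range (n + 1)) {x y : ℕ → R}
    (hx : ∀ l ≤ n, x l ∈ S) (hy : ∀ l ≤ n, y l ∈ S) : peval Φ ![x, y] ∈ S := by
  rw [peval, MvPolynomial.aeval_def, MvPolynomial.eval₂_eq]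
  refine sum_mem fun d hd => mul_mem (by simp) (prod_mem fun q hq => pow_mem ?_ _)
  have hl := Finset.mem_product.1 (hΦ ((MvPolynomial.mem_vars_iff_mem_support q).2 ⟨d, hd, hq⟩))
  obtain ⟨a, l⟩ := q
  have hln : l ≤ n := by simpa [Nat.lt_succ_iff] using hl.2
  fin_cases a
  · exact hx l hln
  · exact hy l hln

theorem add_coeff_mem {S : Subring R} {n : ℕ} {x y : WittVector p R}
    (hx : ∀ l ≤ n, x.coeff l ∈ S) (hy : ∀ l ≤ n, y.coeff l ∈ S) : (x + y).coeff n ∈ S := by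
  rw [add_coeff]; exact peval_mem (wittAdd_vars p n) hx hy

theorem sub_coeff_mem {S : Subring R} {n : ℕ} {x y : WittVector p R}
    (hx : ∀ l ≤ n, x.coeff l ∈ S) (hy : ∀ l ≤ n, y.coeff l ∈ S) : (x - y).coeff n ∈ S := by
  rw [sub_coeff]; exact peval_mem (wittSub_vars p n) hx hy

end WittVector

/-! ### Euler factorization of power series -/

namespace PowerSeries

variable {R : Type*} [CommRing R]

/-- The partial quotients `G ∏_{d ≤ k} (1 - z_d X^d)`, where the `z_d` are chosen such that the
coefficients in the degrees `1, …, k` vanish. -/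
noncomputable def eulerQuotient (G : PowerSeries R) : ℕ → PowerSeries R
  | 0 => G
  | k + 1 => eulerQuotient G k *
      (1 - C (coeff (k + 1) (eulerQuotient G k)) * X ^ (k + 1))

/-- The coefficients `z_d` of the Euler factorization `G = ∏_{d ≥ 1} (1 - z_d X^d)⁻¹` of a power
series with constant coefficient `1`. -/
noncomputable def eulerCoeff (G : PowerSeries R) : ℕ → R
  | 0 => 0
  | k + 1 => coeff (k + 1) (eulerQuotient G k)

theorem eulerQuotient_succ (G : PowerSeries R) (k : ℕ) :
    eulerQuotient G (k + 1) =
      eulerQuotient G k * (1 - C (eulerCoeff G (k + 1)) * X ^ (k + 1)) := rfl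

theorem coeff_eulerQuotient_succ (G : PowerSeries R) (k n : ℕ) :
    coeff n (eulerQuotient G (k + 1)) = coeff n (eulerQuotient G k) -
      if k + 1 ≤ n then coeff (n - (k + 1)) (eulerQuotient G k) * eulerCoeff G (k + 1) else 0 := by
  rw [eulerQuotient_succ, mul_sub, mul_one, map_sub, ← mul_assoc, coeff_mul_X_pow']
  congr 1
  split_ifs <;> simp

theorem coeff_zero_eulerQuotient (G : PowerSeries R) (k : ℕ) :
    coeff 0 (eulerQuotient G k) = coeff 0 G := by
  induction k with
  | zero => rfl
  | succ k ih => rw [coeff_eulerQuotient_succ, ih]; simp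

/-- As the constant term is `1`, the factor `1 - z_{k+1} X^{k+1}` cancels the coefficient in degree
`k + 1`; it does not touch lower degrees. -/
theorem coeff_eulerQuotient_eq_zero {G : PowerSeries R} (hG : coeff 0 G = 1) {k n : ℕ}
    (hn : 1 ≤ n) (hnk : n ≤ k) : coeff n (eulerQuotient G k) = 0 := by
  induction k with
  | zero => omega
  | succ k ih =>
    rw [coeff_eulerQuotient_succ]
    rcases Nat.lt_or_ge n (k + 1) with h | h
    · rw [ih (by omega), if_neg (by omega), sub_zero]
    · obtain rfl : n = k + 1 := by omega
      simp [coeff_zero_eulerQuotient, hG, eulerCoeff, -coeff_zero_eq_constantCoeff]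

/-- The series `∑_{q ≥ 1} k z^q X^{kq}`. -/
noncomputable def eulerLog (z : R) (k : ℕ) : PowerSeries R :=
  mk fun n => if k ∣ n ∧ n ≠ 0 then (k : R) * z ^ (n / k) else 0

/-- `eulerLog z k` is the geometric series `k z X^k / (1 - z X^k)`, that is, `X d/dX` of the
logarithm of `(1 - z X^k)⁻¹`. -/
theorem eulerLog_mul (z : R) (k : ℕ) (hk : k ≠ 0) :
    eulerLog z k * (1 - C z * X ^ k) = C ((k : R) * z) * X ^ k := by
  ext n
  rw [mul_sub, mul_one, map_sub, ← mul_assoc, coeff_mul_X_pow', coeff_C_mul_X_pow]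
  simp only [coeff_mul_C, eulerLog, coeff_mk]
  by_cases hd : k ∣ n
  · obtain ⟨q, rfl⟩ := hd
    rcases q with _ | _ | q
    · simp [hk, Ne.symm hk]
    · simp [hk, Nat.pos_of_ne_zero hk]
    · have h1 : k * (q + 1 + 1) - k = k * (q + 1) := by
        rw [mul_add k (q + 1) 1]; omega
      have h2 : k ≤ k * (q + 1 + 1) := Nat.le_mul_of_pos_right k (by omega)
      have h3 : k * (q + 1 + 1) ≠ k := by
        intro h
        have := Nat.eq_of_mul_eq_mul_left (Nat.pos_of_ne_zero hk) (h.trans (mul_one k).symm)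
        omega
      rw [h1, if_pos h2, if_neg h3, if_pos ⟨dvd_mul_right _ _, by simp [hk]⟩,
        if_pos ⟨dvd_mul_right _ _, by simp [hk]⟩,
        Nat.mul_div_cancel_left _ (Nat.pos_of_ne_zero hk),
        Nat.mul_div_cancel_left _ (Nat.pos_of_ne_zero hk)]
      ring
  · have h3 : n ≠ k := fun h => hd (h ▸ dvd_rfl)
    rw [if_neg (fun h => hd h.1), if_neg h3]
    split_ifs with h h'
    · exact absurd (by simpa [Nat.sub_add_cancel h] using h'.1.add (dvd_refl k)) hd
    · simp
    · simp

theorem X_mul_derivative_eulerQuotient {G V : PowerSeries R}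
    (hV : X * derivative R G = V * G) (k : ℕ) :
    X * derivative R (eulerQuotient G k) =
      (V - ∑ d ∈ Finset.range k, eulerLog (eulerCoeff G (d + 1)) (d + 1)) *
        eulerQuotient G k := by
  induction k with
  | zero => simpa [eulerQuotient] using hV
  | succ k ih =>
    have h := eulerLog_mul (eulerCoeff G (k + 1)) (k + 1) k.succ_ne_zero
    have hd : X * derivative R (1 - C (eulerCoeff G (k + 1)) * X ^ (k + 1)) =
        -(C (((k + 1 : ℕ) : R) * eulerCoeff G (k + 1)) * X ^ (k + 1)) := by
      simp [derivative_C]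
      ring
    rw [eulerQuotient_succ, Finset.sum_range_succ, Derivation.leibniz, smul_eq_mul, smul_eq_mul,
      mul_add, ← mul_assoc, mul_comm X, mul_assoc, hd, ← h, ← mul_assoc, mul_comm X, mul_assoc, ih]
    ring

/-- The ghost components of the big Witt vector `z` with `G = ∏_{d ≥ 1} (1 - z_d X^d)⁻¹` are the
coefficients of the logarithmic derivative of `G`. -/
theorem coeff_log_derivative {G V : PowerSeries R} (hG : coeff 0 G = 1)
    (hV : X * derivative R G = V * G) {n : ℕ} (hn : n ≠ 0) :
    coeff n V = ∑ d ∈ n.divisors, (d : R) * eulerCoeff G d ^ (n / d) := by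
  have h := congrArg (coeff n) (X_mul_derivative_eulerQuotient hV n)
  -- The `n`-th quotient is `1` modulo `X^{n+1}`. So its derivative contributes nothing in degree
  -- `n`, and multiplying by it does not change that coefficient.
  have hL : coeff n (X * derivative R (eulerQuotient G n)) = 0 := by
    obtain ⟨n, rfl⟩ := Nat.exists_eq_succ_of_ne_zero hn
    rw [coeff_succ_X_mul, coeff_derivative,
      coeff_eulerQuotient_eq_zero hG (by omega) (by omega), zero_mul]
  have hR : ∀ W : PowerSeries R, coeff n (W * eulerQuotient G n) = coeff n W := by
    intro W
    rw [coeff_mul, Finset.sum_eq_single (n, 0)]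
    · rw [coeff_zero_eulerQuotient, hG, mul_one]
    · rintro ⟨a, b⟩ hab hne
      have hab := Finset.HasAntidiagonal.mem_antidiagonal.1 hab
      simp only at hab
      have : b ≠ 0 := fun h => hne (by simp [h, ← hab])
      simp only
      rw [coeff_eulerQuotient_eq_zero hG (by omega) (by omega), mul_zero]
    · simp
  rw [hL, hR, map_sub, eq_comm, sub_eq_zero, map_sum] at h
  rw [h, ← Finset.sum_subset (Finset.filter_subset (· + 1 ∣ n) (Finset.range n))]
  · refine Finset.sum_bij (fun d _ => d + 1) ?_ ?_ ?_ ?_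
    · intro d hd
      simp only [Finset.mem_filter] at hd
      simp [hd.2, hn]
    · intro a _ b _ h; omega
    · intro b hb
      have hb := Nat.mem_divisors.1 hb
      have := Nat.pos_of_dvd_of_pos hb.1 (Nat.pos_of_ne_zero hn)
      have hle := Nat.le_of_dvd (Nat.pos_of_ne_zero hn) hb.1
      exact ⟨b - 1, by simp [Nat.sub_add_cancel this, hb.1]; omega, by omega⟩
    · intro d hd
      simp only [Finset.mem_filter] at hd
      simp [eulerLog, hd.2, hn]
  · intro d hd hnd
    have : ¬ d + 1 ∣ n := fun h => hnd (Finset.mem_filter.2 ⟨hd, h⟩)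
    simp [eulerLog, this]

/-- The factorization uses ring operations only, so it introduces no denominators. -/
theorem eulerQuotient_coeff_mem {S : Subring R} {G : PowerSeries R} {N : ℕ}
    (hS : ∀ d ≤ N, coeff d G ∈ S) (k n : ℕ) (hk : k ≤ N) (hn : n ≤ N) :
    coeff n (eulerQuotient G k) ∈ S := by
  induction k generalizing n with
  | zero => exact hS n hn
  | succ k ih =>
    rw [coeff_eulerQuotient_succ]
    refine sub_mem (ih n (by omega) hn) ?_
    split_ifs
    · exact mul_mem (ih _ (by omega) (by omega)) (ih _ (by omega) hk)
    · exact zero_mem _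

theorem eulerCoeff_mem {S : Subring R} {G : PowerSeries R} {n : ℕ}
    (hS : ∀ d ≤ n, coeff d G ∈ S) : eulerCoeff G n ∈ S := by
  cases n with
  | zero => exact zero_mem _
  | succ k => exact eulerQuotient_coeff_mem hS k (k + 1) (by omega) le_rfl

/-- Let `R` act on an additive group through `φ`. If the coefficients of `G` in the degrees
`0 < d < n` kill `v`, then so do the Euler coefficients in these degrees, and in degree `n` both
coefficients act alike. -/
theorem eulerCoeff_apply {A : Type*} [AddCommGroup A] (φ : R →+* AddMonoid.End A)
    {G : PowerSeries R} {n : ℕ} {v : A} (hv : ∀ d, 0 < d → d < n → φ (coeff d G) v = 0)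
    (hn : n ≠ 0) : φ (eulerCoeff G n) v = φ (coeff n G) v := by
  have key : ∀ k < n, ∀ d ≤ n, φ (coeff d (eulerQuotient G k)) v = φ (coeff d G) v := by
    intro k
    induction k with
    | zero => intro _ _ _; rfl
    | succ k ih =>
      intro hk d hd
      have hz : φ (eulerCoeff G (k + 1)) v = 0 := by
        rw [eulerCoeff, ih (by omega) _ (by omega), hv _ (by omega) hk]
      rw [coeff_eulerQuotient_succ, map_sub]
      change φ _ v - φ _ v = _
      rw [ih (by omega) d hd]
      split_ifs
      · rw [map_mul]
        change _ - φ _ (φ _ v) = _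
        rw [hz, map_zero, sub_zero]
      · simp
  obtain ⟨k, rfl⟩ := Nat.exists_eq_succ_of_ne_zero hn
  exact key k (by omega) (k + 1) le_rfl

end PowerSeries

/-! ### Ghost components of finite families -/

section GhostComp

variable {p : ℕ}

theorem ghostComp_eq_sum_range {A : Type*} [Ring A] {m : ℕ} (f : ℕ → A) (i : Fin m) :
    ghostComp p (fun l : Fin m => f l) i =
      ∑ l ∈ Finset.range (i + 1), (p : A) ^ l * f l ^ p ^ ((i : ℕ) - l) := by
  have h := Fin.sum_univ_eq_sum_range
    (fun l => if l ≤ (i : ℕ) then (p : A) ^ l * f l ^ p ^ ((i : ℕ) - l) else 0) m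
  refine h.trans ?_
  rw [← Finset.sum_filter]
  congr 1
  ext l
  simp only [Finset.mem_filter, Finset.mem_range]
  omega

theorem map_ghostComp {A B : Type*} [Ring A] [Ring B] {m : ℕ} (φ : A →+* B) (x : Fin m → A)
    (i : Fin m) : φ (ghostComp p x i) = ghostComp p (fun l => φ (x l)) i := by
  simp [ghostComp, map_sum, apply_ite φ]

theorem ghostComp_eq_add {A : Type*} [Ring A] {m : ℕ} (x : Fin m → A) (i : Fin m) :
    ghostComp p x i = (p : A) ^ (i : ℕ) * x i +
      ∑ l ∈ Finset.univ.filter (· < i), (p : A) ^ (l : ℕ) * x l ^ p ^ ((i : ℕ) - l) := by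
  rw [ghostComp, ← Finset.sum_filter, ← Finset.add_sum_erase _ _ (a := i) (by simp)]
  congr 1
  · simp
  · refine Finset.sum_congr ?_ fun _ _ => rfl
    ext l
    simp [lt_iff_le_and_ne, and_comm]

theorem eq_of_ghostComp_eq {A : Type*} [Ring A] (htf : ∀ (j : ℕ) (r : A), (p : A) ^ j * r = 0 → r = 0)
    {m : ℕ} {x y : Fin m → A} (i : Fin m) (h : ∀ l ≤ i, ghostComp p x l = ghostComp p y l) :
    x i = y i := by
  induction i using WellFoundedLT.induction with
  | _ i ih =>
    have hi := h i le_rfl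
    rw [ghostComp_eq_add, ghostComp_eq_add, Finset.sum_congr rfl fun l hl => by
      rw [ih l (Finset.mem_filter.1 hl).2 fun l' hl' =>
        h l' (hl'.trans (Finset.mem_filter.1 hl).2.le)]] at hi
    exact sub_eq_zero.1 (htf i _ (by rw [mul_sub, add_right_cancel hi, sub_self]))

end GhostComp

theorem natCast_pow_mul_eq_zero {R : Type*} [Ring R] [IsDomain R] [CharZero R] {p : ℕ}
    [hp : Fact p.Prime] (j : ℕ) (r : R) (h : (p : R) ^ j * r = 0) : r = 0 := by
  simpa [hp.out.ne_zero] using h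

open MvPolynomial in
/-- A derivation along a ring homomorphism is determined by its values on the ghost components. -/
theorem MvPolynomial.derivation_eq_zero {p m : ℕ} [Fact p.Prime] {k R : Type*} [CommRing k]
    [CommRing R] [IsDomain R] [CharZero R] (φ : MvPolynomial (Fin m) k →+* R)
    (δ : MvPolynomial (Fin m) k →+ R) (hmul : ∀ f g, δ (f * g) = φ f * δ g + φ g * δ f)
    (hC : ∀ c, δ (C c) = 0) (hw : ∀ i : Fin m, δ (ghostComp p X i) = 0) (f) : δ f = 0 := by
  have hpow : ∀ (j : ℕ) f, δ ((p : MvPolynomial (Fin m) k) ^ j * f) = (p : R) ^ j * δ f := by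
    intro j f
    rw [hmul, ← map_natCast C p, ← map_pow, hC]
    simp
  have hX : ∀ i, δ (X i) = 0 := by
    intro i
    induction i using WellFoundedLT.induction with
    | _ i ih =>
      have hn : ∀ l < i, ∀ n, δ (X l ^ n) = 0 := by
        intro l hl n
        induction n with
        | zero => simpa using hC 1
        | succ n ihn => rw [pow_succ, hmul, ihn, ih l hl]; simp
      have hi := hw i
      rw [ghostComp_eq_add, map_add, hpow, map_sum, Finset.sum_eq_zero, add_zero] at hi
      · exact natCast_pow_mul_eq_zero _ _ hi
      · intro l hl
        rw [hpow, hn l (Finset.mem_filter.1 hl).2, mul_zero]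
  induction f using MvPolynomial.induction_on with
  | C a => exact hC a
  | add f g hf hg => rw [map_add, hf, hg, add_zero]
  | mul_X f i hf => rw [hmul, hf, hX]; simp

/-! ### Translations of Witt coordinates and their coefficient operators -/

namespace WittTranslation

open Polynomial (lcoeff)

variable (p : ℕ) [hp : Fact p.Prime] (m : ℕ) (k : Type*) [CommRing k]

/-- The generic Witt vector `(x_0, …, x_{m-1}, 0, …)`. -/
noncomputable def generic : WittVector p (Polynomial (MvPolynomial (Fin m) k)) :=
  WittVector.mk p fun l => if h : l < m then Polynomial.C (MvPolynomial.X ⟨l, h⟩) else 0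

/-- The translation `f(x) ↦ f(x + V^i [t])` in Witt coordinates, where `t` is the polynomial
variable. -/
noncomputable def translate (i : ℕ) :
    MvPolynomial (Fin m) k →ₐ[k] Polynomial (MvPolynomial (Fin m) k) :=
  MvPolynomial.aeval fun l : Fin m => (generic p m k +
    WittVector.verschiebung^[i] (WittVector.teichmuller p Polynomial.X)).coeff l

/-- The coefficient of `t^d` in the translation by `V^i [t]`. -/
noncomputable def op (i d : ℕ) : Module.End k (MvPolynomial (Fin m) k) :=
  ((lcoeff (MvPolynomial (Fin m) k) d).restrictScalars k) ∘ₗ (translate p m k i).toLinearMap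

variable {m k}

theorem op_apply (i d : ℕ) (f : MvPolynomial (Fin m) k) :
    op p m k i d f = (translate p m k i f).coeff d := rfl

/-- Ghost components turn Witt addition into addition, and `w_l(V^i[t]) = p^i t^{p^{l-i}}` for `i ≤
l`. -/
theorem translate_ghostComp (i : ℕ) (l : Fin m) :
    translate p m k i (ghostComp p MvPolynomial.X l) =
      Polynomial.C (ghostComp p MvPolynomial.X l) +
        if i ≤ l then (p : Polynomial (MvPolynomial (Fin m) k)) ^ i * Polynomial.X ^ p ^ ((l : ℕ) - i)
          else 0 := by
  have h1 := map_ghostComp (p := p) (translate p m k i).toRingHom MvPolynomial.X l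
  have h2 := map_ghostComp (p := p) (Polynomial.C : MvPolynomial (Fin m) k →+* _) MvPolynomial.X l
  simp only [translate, AlgHom.toRingHom_eq_coe, RingHom.coe_coe, MvPolynomial.aeval_X] at h1
  rw [translate, h1, ghostComp_eq_sum_range, ← WittVector.ghostComponent_eq_sum, map_add,
    WittVector.ghostComponent_verschiebung_iterate, WittVector.ghostComponent_teichmuller, h2]
  congr 1
  rw [WittVector.ghostComponent_eq_sum, ← ghostComp_eq_sum_range]
  congr 1
  ext l
  simp [generic]

theorem op_leibniz (i d : ℕ) (f g : MvPolynomial (Fin m) k) :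
    op p m k i d (f * g) =
      ∑ q ∈ Finset.HasAntidiagonal.antidiagonal d, op p m k i q.1 f * op p m k i q.2 g := by
  simp [op_apply, Polynomial.coeff_mul]

theorem op_C (i d : ℕ) (c : k) :
    op p m k i d (MvPolynomial.C c) = if d = 0 then MvPolynomial.C c else 0 := by
  rw [op_apply, MvPolynomial.algHom_C, Polynomial.algebraMap_apply, Polynomial.coeff_C]
  rfl

/-- The derivation `p^j ∂/∂w_j`. -/
noncomputable abbrev ghostDeriv (p : ℕ) [Fact p.Prime] (m : ℕ) (k : Type*) [CommRing k] (j : ℕ) :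
    Module.End k (MvPolynomial (Fin m) k) := op p m k j 1

theorem ghostDeriv_C (j : ℕ) (c : k) : ghostDeriv p m k j (MvPolynomial.C c) = 0 := by
  simp [ghostDeriv, op_C]

theorem ghostDeriv_ghostComp (j : ℕ) (l : Fin m) :
    ghostDeriv p m k j (ghostComp p MvPolynomial.X l) =
      if (l : ℕ) = j then (p : MvPolynomial (Fin m) k) ^ j else 0 := by
  rw [ghostDeriv, op_apply, translate_ghostComp, Polynomial.coeff_add, Polynomial.coeff_C,
    if_neg one_ne_zero, zero_add]
  rcases lt_trichotomy (l : ℕ) j with h | h | h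
  · rw [if_neg (by omega), if_neg (by omega), Polynomial.coeff_zero]
  · rw [if_pos (by omega), if_pos h, h, Nat.sub_self, pow_zero, pow_one, ← Nat.cast_pow,
      Polynomial.coeff_natCast_mul]
    simp
  · have h1 : 1 ≠ p ^ ((l : ℕ) - j) :=
      (Nat.one_lt_pow (by omega) hp.out.one_lt).ne
    rw [if_pos h.le, if_neg h.ne', ← Nat.cast_pow, Polynomial.coeff_natCast_mul,
      Polynomial.coeff_X_pow, if_neg h1, mul_zero]

variable [IsDomain k] [CharZero k]

/-- The ghost components of index below `i` are fixed, and without torsion they determine the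
coordinates below `i`. -/
theorem translate_X_of_lt (i : ℕ) (l : Fin m) (hl : (l : ℕ) < i) :
    translate p m k i (MvPolynomial.X l) = Polynomial.C (MvPolynomial.X l) := by
  refine eq_of_ghostComp_eq (p := p) natCast_pow_mul_eq_zero
    (x := fun l => translate p m k i (MvPolynomial.X l))
    (y := fun l => Polynomial.C (MvPolynomial.X l)) l fun l' hl' => ?_
  refine (map_ghostComp (translate p m k i).toRingHom _ l').symm.trans
    (Eq.trans ?_ (map_ghostComp Polynomial.C _ l'))
  have : ¬ i ≤ (l' : ℕ) := by have : (l' : ℕ) ≤ l := hl'; omega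
  have h := translate_ghostComp (k := k) p i l'
  rw [if_neg this, add_zero] at h
  exact h

theorem translate_X_self (i : Fin m) :
    translate p m k i (MvPolynomial.X i) = Polynomial.C (MvPolynomial.X i) + Polynomial.X := by
  have h := translate_ghostComp (k := k) p i i
  rw [ghostComp_eq_add, if_pos le_rfl, map_add, map_add, map_sum, map_sum,
    Finset.sum_congr rfl fun l hl => by
      rw [map_mul, map_pow (translate p m k i), map_pow (translate p m k i),
        translate_X_of_lt p i l (Finset.mem_filter.1 hl).2, map_natCast],
    Finset.sum_congr (f := fun x => Polynomial.C _) rfl fun l hl => by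
      rw [map_mul, map_pow Polynomial.C, map_pow Polynomial.C, map_natCast],
    map_mul, map_mul, map_pow, map_pow, map_natCast, map_natCast] at h
  refine sub_eq_zero.1 (natCast_pow_mul_eq_zero (p := p) i _ ?_)
  simp only [Nat.sub_self, pow_zero, pow_one] at h
  linear_combination h

theorem op_zero (i : ℕ) : op p m k i 0 = 1 := by
  have h : (Polynomial.constantCoeff.comp (translate p m k i).toRingHom) =
      RingHom.id (MvPolynomial (Fin m) k) := by
    refine MvPolynomial.ringHom_ext (fun c => ?_) fun l => ?_
    · simp
    · refine eq_of_ghostComp_eq (p := p) natCast_pow_mul_eq_zero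
        (x := fun l => (Polynomial.constantCoeff.comp (translate p m k i).toRingHom)
          (MvPolynomial.X l)) (y := MvPolynomial.X) l fun l' _ => ?_
      rw [← map_ghostComp]
      have h := congrArg Polynomial.constantCoeff (translate_ghostComp (k := k) p i l')
      refine h.trans ?_
      have : 0 ≠ p ^ ((l' : ℕ) - i) := (pow_ne_zero _ hp.out.ne_zero).symm
      split_ifs <;> simp [this]
  refine LinearMap.ext fun f => ?_
  exact congrArg (fun φ => φ f) h

theorem ghostDeriv_mul (j : ℕ) (f g : MvPolynomial (Fin m) k) :
    ghostDeriv p m k j (f * g) = f * ghostDeriv p m k j g + g * ghostDeriv p m k j f := by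
  rw [ghostDeriv, op_leibniz, show Finset.HasAntidiagonal.antidiagonal 1 = {(0, 1), (1, 0)} from rfl,
    Finset.sum_pair (by simp), op_zero]
  simp [mul_comm]

theorem ghostDeriv_eq_zero {j : ℕ} (hj : m ≤ j) : ghostDeriv p m k j = 0 := by
  refine LinearMap.ext fun f => ?_
  refine MvPolynomial.derivation_eq_zero (p := p) (RingHom.id _)
    (ghostDeriv p m k j).toAddMonoidHom (ghostDeriv_mul p j) (ghostDeriv_C p j) (fun l => ?_) f
  refine (ghostDeriv_ghostComp p j l).trans (if_neg (by omega))

/-- The commutator is again a derivation. It kills the ghost components because each derivation maps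
them to constants. -/
theorem commute_ghostDeriv (i j : ℕ) : Commute (ghostDeriv p m k i) (ghostDeriv p m k j) := by
  refine sub_eq_zero.1 (LinearMap.ext fun f => ?_)
  refine MvPolynomial.derivation_eq_zero (p := p) (RingHom.id _)
    (ghostDeriv p m k i * ghostDeriv p m k j -
      ghostDeriv p m k j * ghostDeriv p m k i).toAddMonoidHom (fun f g => ?_) (fun c => ?_)
    (fun l => ?_) f
  · simp only [LinearMap.toAddMonoidHom_coe, LinearMap.sub_apply, Module.End.mul_apply,
      ghostDeriv_mul, map_add, RingHom.id_apply]
    ring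
  · simp only [LinearMap.toAddMonoidHom_coe, LinearMap.sub_apply, Module.End.mul_apply,
      ghostDeriv_C, map_zero, sub_zero]
  · have h : ∀ i j, ghostDeriv p m k i (if (l : ℕ) = j then (p : MvPolynomial (Fin m) k) ^ j else 0)
        = 0 := by
      intro i j
      split_ifs
      · rw [← map_natCast MvPolynomial.C p, ← map_pow, ghostDeriv_C]
      · exact map_zero _
    simp only [LinearMap.toAddMonoidHom_coe, LinearMap.sub_apply, Module.End.mul_apply,
      ghostDeriv_ghostComp, h, sub_zero]

open Polynomial in
/-- The differential equation `t ∂/∂t f(x + V^i [t]) = ∑_j t^{p^j} (∂_{i+j} f)(x + V^i [t])`. -/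
theorem X_mul_derivative_translate (i : ℕ) (f : MvPolynomial (Fin m) k) :
    X * derivative (translate p m k i f) =
      ∑ j ∈ Finset.range m, X ^ p ^ j * translate p m k i (ghostDeriv p m k (i + j) f) := by
  -- The defect of the equation is a derivation along the translation, so it is enough to check it
  -- on ghost components.
  let δ : MvPolynomial (Fin m) k →+ (MvPolynomial (Fin m) k)[X] :=
    { toFun := fun f => X * derivative (translate p m k i f) -
        ∑ j ∈ Finset.range m, X ^ p ^ j * translate p m k i (ghostDeriv p m k (i + j) f)
      map_zero' := by simp
      map_add' := fun f g => by
        simp only [map_add, mul_add, Finset.sum_add_distrib]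
        ring }
  refine sub_eq_zero.1 (MvPolynomial.derivation_eq_zero (p := p) (translate p m k i).toRingHom δ
    (fun f g => ?_) (fun c => ?_) (fun l => ?_) f)
  · change X * derivative (translate p m k i (f * g)) - _ =
      translate p m k i f * (_ - _) + translate p m k i g * (_ - _)
    simp only [map_mul, map_add, mul_add, Finset.sum_add_distrib, derivative_mul, ghostDeriv_mul,
      mul_sub, Finset.mul_sum]
    simp only [mul_left_comm (X ^ _)]
    ring
  · change X * derivative (translate p m k i (MvPolynomial.C c)) - _ = 0
    simp only [ghostDeriv_C]
    rw [MvPolynomial.algHom_C, Polynomial.algebraMap_apply]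
    simp
  · change X * derivative (translate p m k i _) - _ = 0
    simp only [ghostDeriv_ghostComp, translate_ghostComp]
    by_cases hil : i ≤ l
    · rw [if_pos hil, Finset.sum_eq_single ((l : ℕ) - i), if_pos (by omega), ← Nat.cast_pow,
        map_add, derivative_C, zero_add, derivative_natCast_mul, derivative_X_pow, map_pow,
        map_natCast]
      · obtain ⟨q, hq⟩ : ∃ q, p ^ ((l : ℕ) - i) = q + 1 :=
          ⟨p ^ ((l : ℕ) - i) - 1, (Nat.sub_add_cancel (Nat.one_le_pow _ _ hp.out.pos)).symm⟩
        rw [hq, Nat.add_sub_cancel, map_natCast, pow_add _ i]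
        have hq' : (p : (MvPolynomial (Fin m) k)[X]) ^ ((l : ℕ) - i) = (q + 1 : ℕ) := by
          rw [← hq]; simp
        rw [hq']
        simp
        ring
      · intro j _ hj
        rw [if_neg (by omega), map_zero, mul_zero]
      · intro h
        exact absurd (Finset.mem_range.2 (by omega)) h
    · rw [if_neg hil, Finset.sum_eq_zero, add_zero, derivative_C, mul_zero, sub_zero]
      intro j _
      rw [if_neg (by omega), map_zero, mul_zero]

/-- This is the coefficient of `t^d` in the differential equation: up to the factor `d`, a recursion
for the operators in terms of the derivations. -/
theorem natCast_mul_op (i d : ℕ) :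
    (d : Module.End k (MvPolynomial (Fin m) k)) * op p m k i d =
      ∑ j ∈ Finset.range m, if p ^ j ≤ d then
        op p m k i (d - p ^ j) * ghostDeriv p m k (i + j) else 0 := by
  refine LinearMap.ext fun f => ?_
  have h := congrArg (fun g => Polynomial.coeff g d) (X_mul_derivative_translate p i f)
  have hL : ((d : Module.End k (MvPolynomial (Fin m) k)) * op p m k i d) f =
      (Polynomial.X * Polynomial.derivative (translate p m k i f)).coeff d := by
    rw [← nsmul_eq_mul, LinearMap.smul_apply, op_apply]
    cases d with
    | zero => simp
    | succ d =>
      rw [Polynomial.coeff_X_mul, Polynomial.coeff_derivative, nsmul_eq_mul, mul_comm]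
      push_cast
      rfl
  rw [hL, h, LinearMap.sum_apply, Polynomial.finsetSum_coeff]
  refine Finset.sum_congr rfl fun j _ => ?_
  rw [mul_comm, Polynomial.coeff_mul_X_pow']
  split_ifs <;> simp [op_apply]

theorem natCast_mul_end_eq_zero {d : ℕ} (hd : d ≠ 0) (T : Module.End k (MvPolynomial (Fin m) k))
    (h : (d : Module.End k (MvPolynomial (Fin m) k)) * T = 0) : T = 0 := by
  refine LinearMap.ext fun f => ?_
  have h := congrArg (fun T => T f) h
  simp only [← nsmul_eq_mul, LinearMap.smul_apply, LinearMap.zero_apply] at h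
  rw [nsmul_eq_mul] at h
  simpa [hd] using h

/-- Induction along `natCast_mul_op`; the factor `d` is cancelled since the endomorphism ring has no
integer torsion. -/
theorem commute_op_of_commute {T : Module.End k (MvPolynomial (Fin m) k)}
    (hT : ∀ j, Commute (ghostDeriv p m k j) T) (i d : ℕ) : Commute (op p m k i d) T := by
  induction d using Nat.strong_induction_on with
  | _ d ih =>
    rcases Nat.eq_zero_or_pos d with rfl | hd
    · rw [op_zero]; exact Commute.one_left T
    · have h : Commute ((d : Module.End k (MvPolynomial (Fin m) k)) * op p m k i d) T := by
        rw [natCast_mul_op]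
        refine Commute.sum_left _ _ _ fun j _ => ?_
        split_ifs
        · exact (ih _ (Nat.sub_lt hd (pow_pos hp.out.pos _))).mul_left (hT _)
        · exact Commute.zero_left T
      refine sub_eq_zero.1 (natCast_mul_end_eq_zero hd.ne' _ ?_)
      have h' := h.eq
      rw [mul_sub, ← mul_assoc, h', ← mul_assoc, ← mul_assoc, (Nat.cast_commute d T).eq, sub_self]

theorem commute_op (i d i' d' : ℕ) : Commute (op p m k i d) (op p m k i' d') :=
  commute_op_of_commute p (fun j => (commute_op_of_commute p
    (fun j' => commute_ghostDeriv p j' j) i' d').symm) i d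

end WittTranslation

/-! ### Witt vectors of operators -/

namespace WittTranslation

variable (p : ℕ) [hp : Fact p.Prime] (m : ℕ) (k : Type*) [CommRing k]

/-- The algebra generated by the coefficients of the translations. -/
def OpAlg : Type _ :=
  Algebra.adjoin k (Set.range fun q : ℕ × ℕ => op p m k q.1 q.2)

variable [IsDomain k] [CharZero k]

-- Commutativity is what allows Witt vectors and Euler products to be formed from operators.
noncomputable instance : CommRing (OpAlg p m k) where
  __ := (Algebra.adjoin k (Set.range fun q : ℕ × ℕ => op p m k q.1 q.2)).toRing
  mul_comm := (Algebra.isMulCommutative_adjoin k (by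
    rintro _ ⟨q, rfl⟩ _ ⟨q', rfl⟩
    exact commute_op p _ _ _ _)).is_comm.comm

noncomputable instance : Algebra k (OpAlg p m k) :=
  inferInstanceAs
    (Algebra k (Algebra.adjoin k (Set.range fun q : ℕ × ℕ => op p m k q.1 q.2)))

/-- The inclusion of `OpAlg` into the algebra of all operators. -/
noncomputable def opVal : OpAlg p m k →ₐ[k] Module.End k (MvPolynomial (Fin m) k) :=
  (Algebra.adjoin k (Set.range fun q : ℕ × ℕ => op p m k q.1 q.2)).val

theorem opVal_injective : Function.Injective (opVal p m k) := Subtype.val_injective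

/-- The coefficient of `t^d` in the translation by `V^i [t]`, as an element of `OpAlg`. -/
noncomputable def opMem (i d : ℕ) : OpAlg p m k :=
  ⟨op p m k i d, Algebra.subset_adjoin ⟨(i, d), rfl⟩⟩

theorem opVal_opMem (i d : ℕ) : opVal p m k (opMem p m k i d) = op p m k i d := rfl

/-- The translation by `V^i [t]` as a power series in `t`. -/
noncomputable def opSeries (i : ℕ) : PowerSeries (OpAlg p m k) := PowerSeries.mk (opMem p m k i)

/-- The Witt vector of operators with ghost components `p^{i+j} ∂/∂w_{i+j}`. -/
noncomputable def opWitt (i : ℕ) : WittVector p (OpAlg p m k) :=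
  WittVector.mk p fun j => (opSeries p m k i).eulerCoeff (p ^ j)

variable {m k}

/-- The Witt vector `opWitt 0 + y`. -/
noncomputable def yWitt (y : ℕ → k) : WittVector p (OpAlg p m k) :=
  opWitt p m k 0 + WittVector.map (algebraMap k (OpAlg p m k)) (WittVector.mk p y)

theorem natCast_mul_opAlg_eq_zero (r : OpAlg p m k) (h : (p : OpAlg p m k) * r = 0) : r = 0 := by
  refine opVal_injective p m k ?_
  rw [map_zero]
  refine natCast_mul_end_eq_zero hp.out.ne_zero _ ?_
  rw [← map_natCast (opVal p m k), ← map_mul, h, map_zero]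

theorem coeff_zero_opSeries (i : ℕ) : PowerSeries.coeff 0 (opSeries p m k i) = 1 := by
  rw [opSeries, PowerSeries.coeff_mk]
  exact opVal_injective p m k (by rw [opVal_opMem, op_zero, map_one])

open PowerSeries in
theorem X_mul_derivative_opSeries (i : ℕ) :
    X * derivative (OpAlg p m k) (opSeries p m k i) =
      (∑ j ∈ Finset.range m, C (opMem p m k (i + j) 1) * X ^ p ^ j) * opSeries p m k i := by
  ext1 d
  rw [Finset.sum_mul, map_sum]
  have hL : coeff d (X * derivative (OpAlg p m k) (opSeries p m k i)) =
      (d : OpAlg p m k) * opMem p m k i d := by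
    cases d with
    | zero => simp
    | succ d =>
      rw [coeff_succ_X_mul, coeff_derivative, opSeries, coeff_mk, mul_comm]
      push_cast
      rfl
  rw [hL]
  refine opVal_injective p m k ?_
  rw [map_mul, map_natCast, opVal_opMem, natCast_mul_op, map_sum]
  refine Finset.sum_congr rfl fun j _ => ?_
  rw [mul_right_comm, coeff_mul_X_pow', coeff_C_mul, opSeries, coeff_mk, mul_comm]
  split_ifs
  · rw [map_mul]; rfl
  · rw [map_zero]

/-- In degree `p^j` the divisor sum of `coeff_log_derivative` runs over the `p^l` with `l ≤ j` and
becomes the `j`-th ghost component. -/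
theorem ghostComponent_opWitt (i j : ℕ) :
    WittVector.ghostComponent j (opWitt p m k i) = opMem p m k (i + j) 1 := by
  have h := PowerSeries.coeff_log_derivative (coeff_zero_opSeries p i)
    (X_mul_derivative_opSeries (m := m) (k := k) p i) (pow_ne_zero j hp.out.ne_zero)
  rw [Nat.sum_divisors_prime_pow hp.out, map_sum] at h
  rw [WittVector.ghostComponent_eq_sum]
  refine Eq.trans (Finset.sum_congr rfl fun l hl => ?_) (h.symm.trans ?_)
  · have hl := Finset.mem_range.1 hl
    rw [Nat.pow_div (by omega) hp.out.pos, opWitt, Nat.cast_pow, WittVector.coeff_mk]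
  · rw [Finset.sum_congr rfl fun l _ => PowerSeries.coeff_C_mul_X_pow _ _ _]
    simp only [Nat.pow_right_inj hp.out.one_lt]
    rw [Finset.sum_ite_eq]
    split_ifs with hj
    · rfl
    -- For `j ≥ m` the logarithmic derivative has no term in degree `p^j`, and the derivation of
    -- index `i + j` is zero as well.
    · refine opVal_injective p m k ?_
      rw [map_zero, opVal_opMem]
      exact (ghostDeriv_eq_zero p (by simp at hj; omega)).symm

/-- Both sides have the ghost components of `opWitt i` shifted by one. -/
theorem frobenius_opWitt (i : ℕ) :
    WittVector.frobenius (opWitt p m k i) = opWitt p m k (i + 1) := by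
  refine WittVector.ext_of_ghostComponent_eq (natCast_mul_opAlg_eq_zero p) fun n => ?_
  rw [WittVector.ghostComponent_frobenius, ghostComponent_opWitt, ghostComponent_opWitt]
  congr 1
  ring

theorem frobenius_iterate_opWitt (i : ℕ) :
    WittVector.frobenius^[i] (opWitt p m k 0) = opWitt p m k i := by
  induction i with
  | zero => rfl
  | succ i ih => rw [Function.iterate_succ_apply', ih, frobenius_opWitt]

theorem opWitt_eq_zero : opWitt p m k m = 0 := by
  refine WittVector.ext_of_ghostComponent_eq (natCast_mul_opAlg_eq_zero p) fun n => ?_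
  rw [ghostComponent_opWitt, map_zero]
  refine opVal_injective p m k ?_
  rw [map_zero, opVal_opMem]
  exact ghostDeriv_eq_zero p (by omega)

/-- The `j`-th coefficient of `opWitt i`. -/
noncomputable def dOp (p : ℕ) [Fact p.Prime] (m : ℕ) (k : Type*) [CommRing k] [IsDomain k]
    [CharZero k] (i j : ℕ) : Module.End k (MvPolynomial (Fin m) k) :=
  opVal p m k ((opWitt p m k i).coeff j)

/-- The `j`-th coefficient of `yWitt y`. -/
noncomputable def yOp (p : ℕ) [Fact p.Prime] (m : ℕ) {k : Type*} [CommRing k] [IsDomain k]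
    [CharZero k] (y : ℕ → k) (j : ℕ) : Module.End k (MvPolynomial (Fin m) k) :=
  opVal p m k ((yWitt (m := m) p y).coeff j)

theorem commute_op_yOp (y : ℕ → k) (i d j : ℕ) : Commute (op p m k i d) (yOp p m y j) :=
  (Commute.all (opMem p m k i d) ((yWitt (m := m) p y).coeff j)).map (opVal p m k)

theorem commute_yOp (y : ℕ → k) (i j : ℕ) : Commute (yOp p m y i) (yOp p m y j) :=
  (Commute.all ((yWitt (m := m) p y).coeff i) ((yWitt (m := m) p y).coeff j)).map (opVal p m k)

theorem sum_yOp (y : ℕ → k) (j : ℕ) :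
    ∑ l ∈ Finset.range (j + 1), (p : Module.End k (MvPolynomial (Fin m) k)) ^ l *
        yOp p m y l ^ p ^ (j - l) =
      ghostDeriv p m k j + algebraMap k _ (∑ l ∈ Finset.range (j + 1),
        (p : k) ^ l * y l ^ p ^ (j - l)) := by
  have h : WittVector.ghostComponent j (yWitt (m := m) p y) = opMem p m k j 1 +
      algebraMap k (OpAlg p m k) (∑ l ∈ Finset.range (j + 1), (p : k) ^ l * y l ^ p ^ (j - l)) := by
    rw [yWitt, map_add, ghostComponent_opWitt, zero_add, WittVector.ghostComponent_eq_sum, map_sum]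
    simp
  rw [WittVector.ghostComponent_eq_sum] at h
  have h := congrArg (opVal p m k) h
  rw [map_sum, map_add, AlgHom.commutes, opVal_opMem] at h
  refine Eq.trans (Finset.sum_congr rfl fun l _ => ?_) h
  rw [map_mul, map_pow, map_pow, map_natCast]
  rfl

/-- The `m`-fold Frobenius kills `opWitt 0`, so it takes `yWitt y` and the constant vector `y` to
the same vector; modulo `p` it is the `p^m`-th power on coordinates. -/
theorem yOp_pow (y : ℕ → k) (j : ℕ) :
    ∃ T, yOp p m y j ^ p ^ m = algebraMap k _ (y j ^ p ^ m) + (p : Module.End k _) * T := by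
  obtain ⟨a, ha⟩ := WittVector.dvd_coeff_frobenius_iterate_sub m (yWitt (m := m) p y) j
  obtain ⟨b, hb⟩ := WittVector.dvd_coeff_frobenius_iterate_sub m
    (WittVector.map (algebraMap k (OpAlg p m k)) (WittVector.mk p y)) j
  have hF : WittVector.frobenius^[m] (yWitt (m := m) p y) = WittVector.frobenius^[m]
      (WittVector.map (algebraMap k (OpAlg p m k)) (WittVector.mk p y)) := by
    rw [yWitt, iterate_map_add, frobenius_iterate_opWitt, opWitt_eq_zero, zero_add]
  rw [hF] at ha
  refine ⟨opVal p m k (b - a), ?_⟩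
  have : ((yWitt (m := m) p y).coeff j) ^ p ^ m =
      algebraMap k (OpAlg p m k) (y j ^ p ^ m) + (p : OpAlg p m k) * (b - a) := by
    rw [map_pow]
    rw [WittVector.map_coeff, WittVector.coeff_mk] at hb
    linear_combination hb - ha
  have := congrArg (opVal p m k) this
  rwa [map_add, map_pow, map_mul, map_natCast, AlgHom.commutes] at this

theorem dOp_pow (i j : ℕ) :
    ∃ T, dOp p m k 0 j ^ p ^ i = dOp p m k i j + (p : Module.End k _) * T := by
  obtain ⟨a, ha⟩ := WittVector.dvd_coeff_frobenius_iterate_sub i (opWitt p m k 0) j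
  rw [frobenius_iterate_opWitt] at ha
  refine ⟨opVal p m k (-a), ?_⟩
  have : ((opWitt p m k 0).coeff j) ^ p ^ i =
      (opWitt p m k i).coeff j + (p : OpAlg p m k) * -a := by
    linear_combination - ha
  have := congrArg (opVal p m k) this
  rwa [map_add, map_pow, map_mul, map_natCast] at this

/-- Witt subtraction of the constant vector recovers `opWitt 0` from `yWitt y`. -/
theorem dOp_mem {S : Subring (Module.End k (MvPolynomial (Fin m) k))} {y : ℕ → k} {j : ℕ}
    (hy : ∀ l ≤ j, algebraMap k _ (y l) ∈ S) (hY : ∀ l ≤ j, yOp p m y l ∈ S) :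
    dOp p m k 0 j ∈ S := by
  have h : opWitt p m k 0 = yWitt (m := m) p y -
      WittVector.map (algebraMap k (OpAlg p m k)) (WittVector.mk p y) := by
    rw [yWitt, add_sub_cancel_right]
  have := WittVector.sub_coeff_mem (S := S.comap (opVal p m k).toRingHom)
    (x := yWitt (m := m) p y)
    (y := WittVector.map (algebraMap k (OpAlg p m k)) (WittVector.mk p y)) (n := j)
    hY (fun l hl => by
      rw [WittVector.map_coeff, WittVector.coeff_mk]
      change opVal p m k (algebraMap k _ (y l)) ∈ S
      rw [AlgHom.commutes]
      exact hy l hl)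
  rw [← h] at this
  exact this

/-- The coordinates up to `j` are built from Euler coefficients of degree at most `p^j`. This bound
later makes `yOp` with `j < n` compatible with truncation at `p^n`. -/
theorem yOp_mem {S : Subring (Module.End k (MvPolynomial (Fin m) k))} {y : ℕ → k} {j : ℕ}
    (hy : ∀ l ≤ j, algebraMap k _ (y l) ∈ S) (hop : ∀ d ≤ p ^ j, op p m k 0 d ∈ S) :
    yOp p m y j ∈ S := by
  refine WittVector.add_coeff_mem (S := S.comap (opVal p m k).toRingHom)
    (x := opWitt p m k 0)
    (y := WittVector.map (algebraMap k (OpAlg p m k)) (WittVector.mk p y)) (n := j)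
    (fun l hl => ?_) (fun l hl => by
      rw [WittVector.map_coeff, WittVector.coeff_mk]
      change opVal p m k (algebraMap k _ (y l)) ∈ S
      rw [AlgHom.commutes]
      exact hy l hl)
  refine PowerSeries.eulerCoeff_mem fun d hd => ?_
  rw [opSeries, PowerSeries.coeff_mk]
  exact hop d (hd.trans (Nat.pow_le_pow_right hp.out.pos hl))

theorem dOp_apply {A : Type*} [AddCommGroup A]
    (φ : Module.End k (MvPolynomial (Fin m) k) →+* AddMonoid.End A) {i j : ℕ} {v : A}
    (hv : ∀ d, 0 < d → d < p ^ j → φ (op p m k i d) v = 0) :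
    φ (dOp p m k i j) v = φ (op p m k i (p ^ j)) v := by
  have := PowerSeries.eulerCoeff_apply (G := opSeries p m k i)
    (φ.comp (opVal p m k).toRingHom) (n := p ^ j) (v := v) (fun d h1 h2 => by
      rw [opSeries, PowerSeries.coeff_mk]
      exact hv d h1 h2) (pow_ne_zero j hp.out.ne_zero)
  rw [opSeries, PowerSeries.coeff_mk] at this
  exact this

end WittTranslation

/-! ### Ordered monomials and normal ordering -/

section OrderedMonomials

variable {A : Type*} [Ring A]

theorem List.prod_ofFn_pow_add {m : ℕ} {x : Fin m → A} (hx : ∀ i j, Commute (x i) (x j))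
    (i j : Fin m → ℕ) : (List.ofFn fun q => x q ^ (i q + j q)).prod =
      (List.ofFn fun q => x q ^ i q).prod * (List.ofFn fun q => x q ^ j q).prod := by
  induction m with
  | zero => simp
  | succ m ih =>
    have hc : Commute (x 0 ^ j 0) (List.ofFn fun q : Fin m => x q.succ ^ i q.succ).prod := by
      refine Commute.list_prod_right _ _ fun a ha => ?_
      obtain ⟨q, rfl⟩ := (List.mem_ofFn' _ _).1 ha
      exact (hx 0 q.succ).pow_pow _ _
    simp only [List.ofFn_succ, List.prod_cons]
    rw [ih (fun a b => hx a.succ b.succ), pow_add, mul_assoc, mul_assoc,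
      ← mul_assoc (x 0 ^ j 0), hc.eq, mul_assoc]

theorem List.prod_ofFn_pow_single {m : ℕ} (x : Fin m → A) (q : Fin m) (N : ℕ) :
    (List.ofFn fun r => x r ^ (Pi.single q N : Fin m → ℕ) r).prod = x q ^ N := by
  induction m with
  | zero => exact q.elim0
  | succ m ih =>
    rw [List.ofFn_succ, List.prod_cons]
    refine Fin.cases ?_ (fun q => ?_) q
    · rw [List.prod_eq_one, Pi.single_eq_same, mul_one]
      intro a ha
      obtain ⟨r, rfl⟩ := (List.mem_ofFn' _ _).1 ha
      simp
    · rw [Pi.single_eq_of_ne (Fin.succ_ne_zero q).symm, pow_zero, one_mul, ← ih (fun r => x r.succ)]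
      congr 2
      ext r
      simp [Pi.single_apply]

theorem mul_prod_ofFn_pow {m : ℕ} {x : Fin m → A} (hx : ∀ i j, Commute (x i) (x j))
    (q : Fin m) (i : Fin m → ℕ) : x q * (List.ofFn fun r => x r ^ i r).prod =
      (List.ofFn fun r => x r ^ ((Pi.single q 1 : Fin m → ℕ) r + i r)).prod := by
  rw [List.prod_ofFn_pow_add hx, List.prod_ofFn_pow_single, pow_one]

theorem map_prod_ofFn_pow {B : Type*} [Ring B] (φ : A →+* B) {m : ℕ} (x : Fin m → A)
    (i : Fin m → ℕ) : φ (List.ofFn fun r => x r ^ i r).prod =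
      (List.ofFn fun r => φ (x r) ^ i r).prod := by
  rw [map_list_prod, List.map_ofFn]
  congr 2
  ext r
  simp

theorem map_normalMonomial {B : Type*} [Ring B] (φ : A →+* B) {m n : ℕ} (x : Fin m → A)
    (y : Fin n → A) (i : Fin m → ℕ) (j : Fin n → ℕ) : φ (normalMonomial x y i j) =
      normalMonomial (fun q => φ (x q)) (fun r => φ (y r)) i j := by
  rw [normalMonomial, map_mul, map_prod_ofFn_pow, map_prod_ofFn_pow, normalMonomial]

theorem map_normalEval {B : Type*} [Ring B] (φ : A →+* B) {m n : ℕ}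
    (c : MvPolynomial (Fin m ⊕ Fin n) ℤ) (x : Fin m → A) (y : Fin n → A) :
    φ (normalEval c x y) = normalEval c (fun q => φ (x q)) (fun r => φ (y r)) := by
  simp [normalEval, map_sum, map_normalMonomial]

variable {R : Type*} [CommRing R] [Algebra R A]

theorem prod_ofFn_pow_mem {m : ℕ} {x : Fin m → A} (S : Subalgebra R A) (hx : ∀ q, x q ∈ S)
    (i : Fin m → ℕ) : (List.ofFn fun q => x q ^ i q).prod ∈ S := by
  refine list_prod_mem fun a ha => ?_
  obtain ⟨q, rfl⟩ := (List.mem_ofFn' _ _).1 ha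
  exact pow_mem (hx q) _

theorem adjoin_le_of_mul_mem {s : Set A} {P : Submodule R A} (h1 : 1 ∈ P)
    (hmul : ∀ a ∈ s, ∀ b ∈ P, a * b ∈ P) : (Algebra.adjoin R s).toSubmodule ≤ P := by
  rw [Algebra.adjoin_eq_span, Submodule.span_le]
  intro a ha
  induction ha using Submonoid.closure_induction_left with
  | one => exact h1
  | mul_left a ha b _ hb => exact hmul a ha b hb

theorem adjoin_le_span_prod_ofFn {m : ℕ} {x : Fin m → A} (hx : ∀ i j, Commute (x i) (x j)) :
    (Algebra.adjoin R (Set.range x)).toSubmodule ≤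
      Submodule.span R (Set.range fun i : Fin m → ℕ => (List.ofFn fun q => x q ^ i q).prod) := by
  refine adjoin_le_of_mul_mem (Submodule.subset_span ⟨0, ?_⟩) ?_
  · refine List.prod_eq_one fun a ha => ?_
    obtain ⟨q, rfl⟩ := (List.mem_ofFn' _ _).1 ha
    simp
  · rintro _ ⟨q, rfl⟩ b hb
    induction hb using Submodule.span_induction with
    | mem b hb =>
      obtain ⟨i, rfl⟩ := hb
      exact Submodule.subset_span ⟨_, (mul_prod_ofFn_pow hx q i).symm⟩
    | zero => rw [mul_zero]; exact zero_mem _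
    | add a b _ _ ha hb => rw [mul_add]; exact add_mem ha hb
    | smul r b _ hb => rw [mul_smul_comm]; exact Submodule.smul_mem _ _ hb

theorem adjoin_le_span_prod_ofFn_fin {m N : ℕ} {x : Fin m → A}
    (hx : ∀ i j, Commute (x i) (x j)) {a : Fin m → R} (hN : 0 < N)
    (ha : ∀ q, x q ^ N = algebraMap R A (a q)) :
    (Algebra.adjoin R (Set.range x)).toSubmodule ≤
      Submodule.span R (Set.range fun i : Fin m → Fin N =>
        (List.ofFn fun q => x q ^ (i q : ℕ)).prod) := by
  refine adjoin_le_of_mul_mem (Submodule.subset_span ⟨fun _ => ⟨0, hN⟩, ?_⟩) ?_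
  · refine List.prod_eq_one fun a ha => ?_
    obtain ⟨q, rfl⟩ := (List.mem_ofFn' _ _).1 ha
    simp
  · rintro _ ⟨q, rfl⟩ b hb
    induction hb using Submodule.span_induction with
    | mem b hb =>
      obtain ⟨i, rfl⟩ := hb
      simp only
      rw [mul_prod_ofFn_pow hx]
      by_cases h : (i q : ℕ) + 1 < N
      · refine Submodule.subset_span ⟨Function.update i q ⟨i q + 1, h⟩, ?_⟩
        simp only
        congr 2
        ext r
        by_cases hr : r = q
        · subst hr; simp [add_comm]
        · simp [hr]
      -- The exponent of `x_q` has reached `N`: it wraps around to `0`, and `x_q^N` leaves the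
      -- scalar `a q`.
      · have hi : (i q : ℕ) + 1 = N := by have := (i q).isLt; omega
        have : (fun r => x r ^ ((Pi.single q 1 : Fin m → ℕ) r + (i r : ℕ))) =
            fun r => x r ^ ((Pi.single q N : Fin m → ℕ) r +
              (Function.update i q ⟨0, hN⟩ r : ℕ)) := by
          ext r
          by_cases hr : r = q
          · subst hr
            simp only [Pi.single_eq_same, Function.update_self]
            congr 1; omega
          · simp [hr]
        rw [this, List.prod_ofFn_pow_add hx, List.prod_ofFn_pow_single, ha, ← Algebra.smul_def]
        exact Submodule.smul_mem _ _ (Submodule.subset_span ⟨_, rfl⟩)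
    | zero => rw [mul_zero]; exact zero_mem _
    | add a b _ _ ha hb => rw [mul_add]; exact add_mem ha hb
    | smul r b _ hb => rw [mul_smul_comm]; exact Submodule.smul_mem _ _ hb

/-- If `[y_j, x_i]` is a normally ordered polynomial in the `x`'s and in the `y_r` with `r < j`,
then every polynomial in the `x`'s and `y`'s may be normally ordered. -/
theorem adjoin_le_adjoin_mul_adjoin {m n : ℕ} (x : Fin m → A) (y : Fin n → A)
    (h : ∀ i j, y j * x i - x i * y j ∈ (Algebra.adjoin R (Set.range x)).toSubmodule *
      (Algebra.adjoin R (y '' {r | r < j})).toSubmodule) :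
    (Algebra.adjoin R (Set.range x ∪ Set.range y)).toSubmodule ≤
      (Algebra.adjoin R (Set.range x)).toSubmodule *
        (Algebra.adjoin R (Set.range y)).toSubmodule := by
  set P := Algebra.adjoin R (Set.range x) with hP
  have hx : ∀ i, x i ∈ P := fun i => Algebra.subset_adjoin ⟨i, rfl⟩
  have hPP : P.toSubmodule * P.toSubmodule = P.toSubmodule :=
    Subalgebra.isIdempotentElem_toSubmodule P
  -- the product of `P` with a subalgebra is a left `P`-module
  have hleft : ∀ (Q : Submodule R A), ∀ i, ∀ b ∈ P.toSubmodule * Q, x i * b ∈ P.toSubmodule * Q := by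
    intro Q i b hb
    rw [← hPP, mul_assoc]
    exact Submodule.mul_mem_mul (hx i) hb
  -- The index set `s` is left free because this is needed both for initial segments, inside the
  -- induction, and for all indices at the end.
  have key : ∀ (s : Set (Fin n)), (∀ j ∈ s, ∀ i, y j * x i - x i * y j ∈ P.toSubmodule *
      (Algebra.adjoin R (y '' {r | r ∈ s ∧ r < j})).toSubmodule) →
      (∀ j ∈ s, (Algebra.adjoin R (y '' {r | r ∈ s ∧ r < j})).toSubmodule * P.toSubmodule ≤
        P.toSubmodule * (Algebra.adjoin R (y '' {r | r ∈ s ∧ r < j})).toSubmodule) →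
      (∀ j ∈ s, ∀ b ∈ P.toSubmodule * (Algebra.adjoin R (y '' s)).toSubmodule,
        y j * b ∈ P.toSubmodule * (Algebra.adjoin R (y '' s)).toSubmodule) := by
    intro s hs hs' j hj b hb
    set Q := Algebra.adjoin R (y '' s) with hQ
    have hy : y j ∈ Q := Algebra.subset_adjoin ⟨j, hj, rfl⟩
    have hle : (Algebra.adjoin R (y '' {r | r ∈ s ∧ r < j})).toSubmodule ≤ Q.toSubmodule :=
      Algebra.adjoin_mono (Set.image_mono fun r hr => hr.1)
    -- Induction on `f` by `y_j x_i f = x_i y_j f + [y_j, x_i] f`. The last term involves only `y_r`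
    -- with `r < j`, which `hs'` moves past `f`.
    have hyP : ∀ f ∈ P.toSubmodule, f ∈ P.toSubmodule ⊓
        (P.toSubmodule * Q.toSubmodule).comap (LinearMap.mulLeft R (y j)) := by
      refine adjoin_le_of_mul_mem ⟨one_mem P, ?_⟩ ?_
      · rw [SetLike.mem_coe, Submodule.mem_comap, LinearMap.mulLeft_apply, mul_one, ← one_mul (y j)]
        exact Submodule.mul_mem_mul (one_mem P) hy
      · rintro _ ⟨i, rfl⟩ f ⟨hf, hf'⟩
        refine ⟨P.mul_mem (hx i) hf, ?_⟩
        rw [SetLike.mem_coe, Submodule.mem_comap, LinearMap.mulLeft_apply] at hf' ⊢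
        have : y j * (x i * f) = x i * (y j * f) + (y j * x i - x i * y j) * f := by noncomm_ring
        rw [this]
        refine add_mem (hleft _ i _ hf') ?_
        have h1 := Submodule.mul_mem_mul (hs j hj i) hf
        rw [mul_assoc] at h1
        have h2 := mul_le_mul' (le_refl P.toSubmodule) (hs' j hj) h1
        rw [← mul_assoc, hPP] at h2
        exact mul_le_mul' le_rfl hle h2
    induction hb using Submodule.mul_induction_on' with
    | mem_mul_mem f hf g hg =>
      have := Submodule.mul_mem_mul (show y j * f ∈ P.toSubmodule * Q.toSubmodule from
        (hyP f hf).2) hg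
      rwa [mul_assoc P.toSubmodule, Subalgebra.isIdempotentElem_toSubmodule Q, mul_assoc] at this
    | add a _ b _ ha hb => rw [mul_add]; exact add_mem ha hb
  have hswap : ∀ j : Fin n, (Algebra.adjoin R (y '' {r | r < j})).toSubmodule * P.toSubmodule ≤
      P.toSubmodule * (Algebra.adjoin R (y '' {r | r < j})).toSubmodule := by
    intro j
    induction j using WellFoundedLT.induction with
    | _ j ih =>
      have hset : ∀ l < j, {r : Fin n | r ∈ {r | r < j} ∧ r < l} = {r | r < l} := by
        intro l hl
        ext r
        exact ⟨fun h => h.2, fun h => ⟨lt_trans h hl, h⟩⟩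
      have hk := key {r | r < j} (fun l hl i => by rw [hset l hl]; exact h i l)
        (fun l hl => by rw [hset l hl]; exact ih l hl)
      rw [Submodule.mul_le]
      intro g hg f hf
      have : (Algebra.adjoin R (y '' {r | r < j})).toSubmodule ≤
          (P.toSubmodule * (Algebra.adjoin R (y '' {r | r < j})).toSubmodule).comap
            (LinearMap.mulRight R f) := by
        refine adjoin_le_of_mul_mem ?_ ?_
        · rw [Submodule.mem_comap, LinearMap.mulRight_apply, one_mul, ← mul_one f]
          exact Submodule.mul_mem_mul hf (one_mem (Algebra.adjoin R _))
        · rintro _ ⟨l, hl, rfl⟩ b hb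
          rw [Submodule.mem_comap, LinearMap.mulRight_apply] at hb ⊢
          rw [mul_assoc]
          exact hk l hl _ hb
      exact this hg
  have hk := key Set.univ (fun j _ i => by simpa using h i j) (fun j _ => by simpa using hswap j)
  rw [Set.image_univ] at hk
  refine adjoin_le_of_mul_mem ?_ ?_
  · rw [← one_mul 1]
    exact Submodule.mul_mem_mul (one_mem P) (one_mem (Algebra.adjoin R (Set.range y)))
  · rintro _ (⟨i, rfl⟩ | ⟨j, rfl⟩) b hb
    · exact hleft _ i b hb
    · exact hk j (Set.mem_univ j) b hb

end OrderedMonomials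

/-! ### Base change of operators, with a shift of the variables -/

section BaseChangeEnd

/-- The action of the endomorphisms of a module on a base change of it. -/
noncomputable def IsBaseChange.endRingHom {R S M N : Type*} [CommRing R] [CommRing S] [Algebra R S]
    [AddCommGroup M] [Module R M] [AddCommGroup N] [Module R N] [Module S N] [IsScalarTower R S N]
    {f : M →ₗ[R] N} (h : IsBaseChange S f) : Module.End R M →+* Module.End S N where
  toFun T := h.lift (f ∘ₗ T)
  map_one' := h.algHom_ext _ _ fun x => by rw [h.lift_eq]; rfl
  map_mul' T U := h.algHom_ext _ _ fun x => by
    rw [h.lift_eq, Module.End.mul_apply, h.lift_eq]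
    exact (h.lift_eq (f ∘ₗ T) (U x)).symm
  map_zero' := h.algHom_ext _ _ fun x => by rw [h.lift_eq]; simp
  map_add' T U := h.algHom_ext _ _ fun x => by
    rw [h.lift_eq, LinearMap.add_apply, h.lift_eq, h.lift_eq]; simp

theorem IsBaseChange.endRingHom_apply {R S M N : Type*} [CommRing R] [CommRing S] [Algebra R S]
    [AddCommGroup M] [Module R M] [AddCommGroup N] [Module R N] [Module S N] [IsScalarTower R S N]
    {f : M →ₗ[R] N} (h : IsBaseChange S f) (T : Module.End R M) (x : M) :
    h.endRingHom T (f x) = f (T x) := h.lift_eq _ _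

namespace MvPolynomial

variable {σ k k' : Type*} [CommRing k] [CommRing k'] [Algebra k k']

/-- The change of coefficients followed by the substitution `X_i ↦ X_i + α_i`. -/
noncomputable def shiftMap (k : Type*) [CommRing k] [Algebra k k'] (α : σ → k') :
    MvPolynomial σ k →ₐ[k] MvPolynomial σ k' :=
  aeval fun i => X i + C (α i)

theorem shiftMap_X (α : σ → k') (i : σ) : shiftMap k α (X i) = X i + C (α i) := by
  simp [shiftMap]

theorem shiftMap_zero_injective (h : Function.Injective (algebraMap k k')) :
    Function.Injective (shiftMap k (0 : σ → k')) := by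
  have : (shiftMap k (0 : σ → k') : MvPolynomial σ k → MvPolynomial σ k') =
      map (algebraMap k k') := by
    have : (shiftMap k (0 : σ → k')).toRingHom = map (algebraMap k k') := by
      refine ringHom_ext (fun c => ?_) fun i => ?_
      · simp [shiftMap, algebraMap_apply]
      · simp [shiftMap]
    exact congrArg DFunLike.coe this
  rw [this]
  exact map_injective _ h

/-- The shift is an automorphism of the polynomial ring over `k'`, so composing with it preserves
the usual base change property. -/
theorem isBaseChange_shiftMap (α : σ → k') :
    IsBaseChange k' (shiftMap k α).toLinearMap := by
  let e : MvPolynomial σ k' ≃ₐ[k'] MvPolynomial σ k' := AlgEquiv.ofAlgHom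
    (aeval fun i => X i + C (α i)) (aeval fun i => X i - C (α i))
    (algHom_ext fun i => by simp [algHom_C, algebraMap_eq])
    (algHom_ext fun i => by simp [algHom_C, algebraMap_eq])
  refine IsBaseChange.of_equiv ((algebraTensorAlgEquiv k k').trans e).toLinearEquiv fun f => ?_
  have : (((algebraTensorAlgEquiv k k').trans e).toAlgHom.restrictScalars k).comp
      (Algebra.TensorProduct.includeRight : MvPolynomial σ k →ₐ[k] _) = shiftMap k α :=
    algHom_ext fun i => by simp [e, shiftMap]
  exact congrArg (fun φ => φ f) this

/-- The base change of operators along `shiftMap k α`. -/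
noncomputable def endShift (α : σ → k') :
    Module.End k (MvPolynomial σ k) →+* Module.End k' (MvPolynomial σ k') :=
  (isBaseChange_shiftMap (k := k) α).endRingHom

theorem endShift_apply (α : σ → k') (T : Module.End k (MvPolynomial σ k)) (f : MvPolynomial σ k) :
    endShift α T (shiftMap k α f) = shiftMap k α (T f) :=
  (isBaseChange_shiftMap (k := k) α).endRingHom_apply T f

theorem end_ext_shift (α : σ → k') {T U : Module.End k' (MvPolynomial σ k')}
    (h : ∀ f : MvPolynomial σ k, T (shiftMap k α f) = U (shiftMap k α f)) : T = U :=
  (isBaseChange_shiftMap (k := k) α).algHom_ext _ _ h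

theorem endShift_algebraMap (α : σ → k') (c : k) :
    endShift α (algebraMap k (Module.End k (MvPolynomial σ k)) c) = algebraMap k' _ (algebraMap k k' c) :=
  end_ext_shift (k := k) α fun f => by
    rw [endShift_apply, Module.algebraMap_end_apply, Module.algebraMap_end_apply, map_smul,
      algebraMap_smul]

theorem endShift_mulLeft (α : σ → k') (f : MvPolynomial σ k) :
    endShift α (LinearMap.mulLeft k f) = LinearMap.mulLeft k' (shiftMap k α f) :=
  end_ext_shift (k := k) α fun g => by
    rw [endShift_apply, LinearMap.mulLeft_apply, LinearMap.mulLeft_apply, map_mul]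

/-- This brings operator identities proved over a `ℚ`-algebra back to integral coefficients. -/
theorem endShift_zero_injective (h : Function.Injective (algebraMap k k')) :
    Function.Injective (endShift (k := k) (0 : σ → k')) := by
  intro T U hTU
  refine LinearMap.ext fun f => shiftMap_zero_injective h ?_
  rw [← endShift_apply, hTU, endShift_apply]

end MvPolynomial

end BaseChangeEnd

/-! ### Ghost components of commuting families -/

section GhostComp

variable {p : ℕ} {A : Type*} [Ring A]

theorem commute_ghostComp {m n : ℕ} {x : Fin m → A} {y : Fin n → A}
    (h : ∀ i j, Commute (x i) (y j)) (i : Fin m) (j : Fin n) :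
    Commute (ghostComp p x i) (ghostComp p y j) := by
  refine Commute.sum_left _ _ _ fun a _ => Commute.sum_right _ _ _ fun b _ => ?_
  split_ifs
  · have h1 : ∀ (N : ℕ) z, Commute ((p : A) ^ N) z := fun N z => (Nat.cast_commute p z).pow_left N
    exact ((h1 _ _).mul_right (h1 _ _)).mul_left
      (((h1 _ _).symm.mul_right ((h a b).pow_pow _ _)))
  · exact Commute.zero_right _
  · exact Commute.zero_left _
  · exact Commute.zero_left _

theorem ghostComp_castLE {a m : ℕ} (ham : a ≤ m) (x : Fin m → A) (i : Fin a) :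
    ghostComp p (fun q : Fin a => x (q.castLE ham)) i = ghostComp p x (i.castLE ham) := by
  have h1 : (fun q : Fin a => x (q.castLE ham)) =
      fun q : Fin a => (fun l : ℕ => if h : l < m then x ⟨l, h⟩ else 0) q := by
    ext q
    simp [q.isLt.trans_le ham]
    rfl
  have h2 : x = fun q : Fin m => (fun l : ℕ => if h : l < m then x ⟨l, h⟩ else 0) q := by
    ext q
    simp
  have h3 := congrArg (fun f => ghostComp p f (i.castLE ham)) h2
  refine (congrArg (fun f => ghostComp p f i) h1).trans (Eq.trans ?_ h3.symm)
  exact (ghostComp_eq_sum_range (fun l : ℕ => if h : l < m then x ⟨l, h⟩ else 0) i).trans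
    (ghostComp_eq_sum_range (fun l : ℕ => if h : l < m then x ⟨l, h⟩ else 0) (i.castLE ham)).symm

end GhostComp

/-! ### The rational algebra -/

section RatB

variable {p m n : ℕ}

theorem ghostComp_ratX (i : Fin m) : ghostComp p (ratX p m n) i =
    RingQuot.mkAlgHom ℚ (RatBRel p m n) (ghostComp p (freeX ℚ m n) i) :=
  (map_ghostComp (RingQuot.mkAlgHom ℚ (RatBRel p m n)).toRingHom _ _).symm

theorem ghostComp_ratY (j : Fin n) : ghostComp p (ratY p m n) j =
    RingQuot.mkAlgHom ℚ (RatBRel p m n) (ghostComp p (freeY ℚ m n) j) :=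
  (map_ghostComp (RingQuot.mkAlgHom ℚ (RatBRel p m n)).toRingHom _ _).symm

theorem commute_ghostComp_ratX (i j : Fin m) :
    Commute (ghostComp p (ratX p m n) i) (ghostComp p (ratX p m n) j) := by
  rw [ghostComp_ratX, ghostComp_ratX, Commute, SemiconjBy, ← map_mul, ← map_mul]
  exact RingQuot.mkAlgHom_rel ℚ (RatBRel.xx i j)

theorem commute_ghostComp_ratY (i j : Fin n) :
    Commute (ghostComp p (ratY p m n) i) (ghostComp p (ratY p m n) j) := by
  rw [ghostComp_ratY, ghostComp_ratY, Commute, SemiconjBy, ← map_mul, ← map_mul]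
  exact RingQuot.mkAlgHom_rel ℚ (RatBRel.yy i j)

theorem ghostComp_ratY_mul_ratX (i : Fin m) (j : Fin n) :
    ghostComp p (ratY p m n) j * ghostComp p (ratX p m n) i -
      ghostComp p (ratX p m n) i * ghostComp p (ratY p m n) j =
        if (i : ℕ) = j then (p : RatB p m n) ^ (i : ℕ) else 0 := by
  rw [ghostComp_ratX, ghostComp_ratY, ← map_mul, ← map_mul, ← map_sub,
    RingQuot.mkAlgHom_rel ℚ (RatBRel.yx i j), apply_ite (RingQuot.mkAlgHom ℚ (RatBRel p m n)),
    map_pow, map_natCast, map_zero]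

theorem exists_ratB_lift {S : Type*} [Ring S] [Algebra ℚ S] (X : Fin m → S) (Y : Fin n → S)
    (hX : ∀ i j, Commute (X i) (X j)) (hY : ∀ i j, Commute (Y i) (Y j))
    (hYX : ∀ i j, ghostComp p Y j * ghostComp p X i - ghostComp p X i * ghostComp p Y j =
      if (i : ℕ) = j then (p : S) ^ (i : ℕ) else 0) :
    ∃ ρ : RatB p m n →ₐ[ℚ] S, (∀ i, ρ (ratX p m n i) = X i) ∧ ∀ j, ρ (ratY p m n j) = Y j := by
  let φ : FreeAlgebra ℚ (Fin m ⊕ Fin n) →ₐ[ℚ] S := FreeAlgebra.lift ℚ (Sum.elim X Y)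
  have hφX : ∀ i, φ (ghostComp p (freeX ℚ m n) i) = ghostComp p X i := fun i => by
    refine (map_ghostComp φ.toRingHom _ _).trans ?_
    congr 1
    ext q
    simp [φ, freeX]
  have hφY : ∀ i, φ (ghostComp p (freeY ℚ m n) i) = ghostComp p Y i := fun i => by
    refine (map_ghostComp φ.toRingHom _ _).trans ?_
    congr 1
    ext q
    simp [φ, freeY]
  refine ⟨RingQuot.liftAlgHom ℚ ⟨φ, ?_⟩, fun i => ?_, fun j => ?_⟩
  · rintro _ _ (⟨i, j⟩ | ⟨i, j⟩ | ⟨i, j⟩)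
    · rw [map_mul, map_mul, hφX, hφX]
      exact commute_ghostComp hX i j
    · rw [map_mul, map_mul, hφY, hφY]
      exact commute_ghostComp hY i j
    · rw [map_sub, map_mul, map_mul, hφX, hφY, hYX, apply_ite φ, map_pow, map_natCast, map_zero]
  · rw [ratX, RingQuot.liftAlgHom_mkAlgHom_apply]
    simp [φ, freeX]
  · rw [ratY, RingQuot.liftAlgHom_mkAlgHom_apply]
    simp [φ, freeY]

/-- The ghost components are triangular in the `x_i` with diagonal entries `p^i`, which are
invertible over `ℚ`. -/
theorem mem_adjoin_ghostComp (hp : p ≠ 0) {A : Type*} [Ring A] [Algebra ℚ A] (x : Fin m → A)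
    (i : Fin m) : x i ∈ Algebra.adjoin ℚ (Set.range (ghostComp p x)) := by
  induction i using WellFoundedLT.induction with
  | _ i ih =>
    have h1 : (p : A) ^ (i : ℕ) * x i ∈ Algebra.adjoin ℚ (Set.range (ghostComp p x)) := by
      rw [eq_sub_of_add_eq (ghostComp_eq_add (p := p) x i).symm]
      refine sub_mem (Algebra.subset_adjoin ⟨i, rfl⟩) (sum_mem fun l hl => mul_mem ?_
        (pow_mem (ih l (Finset.mem_filter.1 hl).2) _))
      exact pow_mem (natCast_mem _ p) _
    have h2 : x i = ((p : ℚ) ^ (i : ℕ))⁻¹ • ((p : A) ^ (i : ℕ) * x i) := by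
      have : (p : A) ^ (i : ℕ) * x i = ((p : ℚ) ^ (i : ℕ)) • x i := by
        rw [Algebra.smul_def, map_pow, map_natCast]
      rw [this, smul_smul, inv_mul_cancel₀ (pow_ne_zero _ (Nat.cast_ne_zero.2 hp)), one_smul]
    rw [h2]
    exact Subalgebra.smul_mem _ h1 _

theorem adjoin_range_ghostComp (hp : p ≠ 0) {A : Type*} [Ring A] [Algebra ℚ A] (x : Fin m → A) :
    Algebra.adjoin ℚ (Set.range (ghostComp p x)) = Algebra.adjoin ℚ (Set.range x) := by
  refine le_antisymm (Algebra.adjoin_le ?_) (Algebra.adjoin_le ?_)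
  · rintro _ ⟨i, rfl⟩
    refine sum_mem fun l _ => ?_
    split_ifs
    · exact mul_mem (pow_mem (natCast_mem _ p) _)
        (pow_mem (Algebra.subset_adjoin (Set.mem_range_self l)) _)
    · exact zero_mem _
  · rintro _ ⟨i, rfl⟩
    exact mem_adjoin_ghostComp hp x i

theorem commute_of_commute_ghostComp (hp : p ≠ 0) {A : Type*} [Ring A] [Algebra ℚ A]
    {x : Fin m → A} (h : ∀ i j, Commute (ghostComp p x i) (ghostComp p x j)) (i j : Fin m) :
    Commute (x i) (x j) := by
  have hc : IsMulCommutative (Algebra.adjoin ℚ (Set.range (ghostComp p x))) :=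
    Algebra.isMulCommutative_adjoin ℚ (by
      rintro _ ⟨i, rfl⟩ _ ⟨j, rfl⟩
      exact h i j)
  let S := Algebra.adjoin ℚ (Set.range (ghostComp p x))
  have hij := hc.is_comm.comm (⟨x i, mem_adjoin_ghostComp hp x i⟩ : S)
    (⟨x j, mem_adjoin_ghostComp hp x j⟩ : S)
  exact congrArg Subtype.val hij

theorem mkAlgHom_adjoin_eq_top {R : Type*} [CommRing R]
    (r : FreeAlgebra R (Fin m ⊕ Fin n) → FreeAlgebra R (Fin m ⊕ Fin n) → Prop) :
    Algebra.adjoin R (Set.range (fun i => RingQuot.mkAlgHom R r (freeX R m n i)) ∪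
      Set.range (fun j => RingQuot.mkAlgHom R r (freeY R m n j))) = ⊤ := by
  have h := congrArg (Subalgebra.map (RingQuot.mkAlgHom R r))
    (FreeAlgebra.adjoin_range_ι R (Fin m ⊕ Fin n))
  rw [Algebra.map_top, (AlgHom.range_eq_top _).2 (RingQuot.mkAlgHom_surjective R r),
    AlgHom.map_adjoin] at h
  rw [← h, ← Set.range_comp]
  congr 1
  ext a
  simp [freeX, freeY]

/-- The ghost components generate the same subalgebras as the `x`'s and as the `y`'s, and their
mixed commutators are scalars. So normal ordering is done in ghost coordinates, then translated
back. -/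
theorem ratB_span_normalMonomial (hp : p ≠ 0) :
    Submodule.span ℚ (Set.range fun e : (Fin m → ℕ) × (Fin n → ℕ) =>
      normalMonomial (ratX p m n) (ratY p m n) e.1 e.2) = ⊤ := by
  have hX := adjoin_range_ghostComp hp (ratX p m n)
  have hY := adjoin_range_ghostComp hp (ratY p m n)
  have h1 := adjoin_le_adjoin_mul_adjoin (R := ℚ) (ghostComp p (ratX p m n))
    (ghostComp p (ratY p m n)) (fun i j => by
      rw [ghostComp_ratY_mul_ratX, ← one_mul (ite _ _ _)]
      refine Submodule.mul_mem_mul (one_mem (Algebra.adjoin ℚ _)) ?_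
      split_ifs
      · exact pow_mem (natCast_mem (Algebra.adjoin ℚ _) p) _
      · exact zero_mem _)
  rw [Algebra.adjoin_union, hX, hY, ← Algebra.adjoin_union] at h1
  have htop : Algebra.adjoin ℚ (Set.range (ratX p m n) ∪ Set.range (ratY p m n)) = ⊤ :=
    mkAlgHom_adjoin_eq_top (RatBRel p m n)
  rw [htop, Algebra.top_toSubmodule] at h1
  refine top_le_iff.1 (h1.trans ((mul_le_mul'
    (adjoin_le_span_prod_ofFn (commute_of_commute_ghostComp hp commute_ghostComp_ratX))
    (adjoin_le_span_prod_ofFn (commute_of_commute_ghostComp hp commute_ghostComp_ratY))).trans ?_))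
  rw [Submodule.span_mul_span, Submodule.span_le]
  rintro _ ⟨_, ⟨i, rfl⟩, _, ⟨j, rfl⟩, rfl⟩
  exact Submodule.subset_span ⟨(i, j), rfl⟩

end RatB

/-! ### Evaluating normally ordered operators at `1` -/

namespace MvPolynomial

variable {σ k : Type*} [CommRing k]

theorem prod_ofFn_pow_apply_one {n : ℕ} {Y : Fin n → Module.End k (MvPolynomial σ k)} {b : Fin n → k}
    (hY : ∀ r, Y r 1 = C (b r)) (j : Fin n → ℕ) :
    (List.ofFn fun r => Y r ^ j r).prod 1 = C (∏ r, b r ^ j r) := by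
  have hC : ∀ r (c : k), Y r (C c) = C (b r * c) := by
    intro r c
    have : (C c : MvPolynomial σ k) = c • 1 := by rw [smul_eq_C_mul, mul_one]
    rw [this, map_smul, hY, smul_eq_C_mul, ← C_mul, mul_comm]
  have hpow : ∀ r N (c : k), (Y r ^ N) (C c) = C (b r ^ N * c) := by
    intro r N c
    induction N with
    | zero => simp
    | succ N ih => rw [pow_succ', Module.End.mul_apply, ih, hC, pow_succ', mul_assoc]
  induction n with
  | zero => simp
  | succ n ih =>
    rw [List.ofFn_succ, List.prod_cons, Module.End.mul_apply,
      ih (fun r => hY r.succ) _ (fun r => hC r.succ) (fun r => hpow r.succ), hpow,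
      Fin.prod_univ_succ]

theorem normalMonomial_apply_one {m n : ℕ} (a : Fin m → MvPolynomial σ k)
    {Y : Fin n → Module.End k (MvPolynomial σ k)} {b : Fin n → k} (hY : ∀ r, Y r 1 = C (b r))
    (i : Fin m → ℕ) (j : Fin n → ℕ) :
    normalMonomial (fun q => LinearMap.mulLeft k (a q)) Y i j 1 =
      (∏ q, a q ^ i q) * C (∏ r, b r ^ j r) := by
  have h := map_prod_ofFn_pow (Algebra.lmul k (MvPolynomial σ k)).toRingHom a i
  rw [List.prod_ofFn] at h
  rw [normalMonomial, Module.End.mul_apply, prod_ofFn_pow_apply_one hY]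
  exact (congrArg (fun T : Module.End k (MvPolynomial σ k) => T (C (∏ r, b r ^ j r))) h).symm

theorem normalEval_apply_one {m n : ℕ} (c : MvPolynomial (Fin m ⊕ Fin n) ℤ)
    (a : Fin m → MvPolynomial σ k) {Y : Fin n → Module.End k (MvPolynomial σ k)} {b : Fin n → k}
    (hY : ∀ r, Y r 1 = C (b r)) :
    normalEval c (fun q => LinearMap.mulLeft k (a q)) Y 1 =
      aeval (Sum.elim a fun r => C (b r)) c := by
  rw [normalEval, LinearMap.sum_apply, aeval_def, eval₂_eq']
  refine Finset.sum_congr rfl fun e _ => ?_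
  rw [Module.End.mul_apply, normalMonomial_apply_one a hY, Fintype.prod_sum_type, ← zsmul_one,
    LinearMap.smul_apply, Module.End.one_apply, zsmul_eq_mul]
  simp [map_prod]

theorem linearIndependent_prod_pow_mul {m n : ℕ} : LinearIndependent ℚ
    fun e : (Fin m → ℕ) × (Fin n → ℕ) => ((∏ q, X q ^ e.1 q) * C (∏ r, X r ^ e.2 r) :
      MvPolynomial (Fin m) (MvPolynomial (Fin n) ℚ)) := by
  have h1 := ((basisMonomials (Fin m ⊕ Fin n) ℚ).map
    (sumAlgEquiv ℚ (Fin m) (Fin n)).toLinearEquiv).linearIndependent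
  have h2 := h1.comp (fun e : (Fin m → ℕ) × (Fin n → ℕ) =>
    Finsupp.equivFunOnFinite.symm (Sum.elim e.1 e.2)) (fun (e e' : (Fin m → ℕ) × (Fin n → ℕ)) h => by
      have h : Sum.elim e.1 e.2 = Sum.elim e'.1 e'.2 := Finsupp.equivFunOnFinite.symm.injective h
      have hl : e.1 = e'.1 := by
        funext q
        exact congrFun h (Sum.inl q)
      have hr : e.2 = e'.2 := by
        funext r
        exact congrFun h (Sum.inr r)
      exact Prod.ext hl hr)
  suffices he : (fun e : (Fin m → ℕ) × (Fin n → ℕ) => ((∏ q, X q ^ e.1 q) * C (∏ r, X r ^ e.2 r) :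
      MvPolynomial (Fin m) (MvPolynomial (Fin n) ℚ))) =
      ((basisMonomials (Fin m ⊕ Fin n) ℚ).map (sumAlgEquiv ℚ (Fin m) (Fin n)).toLinearEquiv) ∘
        fun e => Finsupp.equivFunOnFinite.symm (Sum.elim e.1 e.2) by
    rw [he]; exact h2
  ext1 e
  simp only [Function.comp_apply, Module.Basis.map_apply, coe_basisMonomials,
    AlgEquiv.toLinearEquiv_apply]
  rw [monomial_eq, Finsupp.prod_fintype _ _ (by simp), Fintype.prod_sum_type]
  simp [map_prod]

end MvPolynomial

/-- The representation of `B_{m,n}(ℚ)` by operators on `ℚ[x, y]` is faithful, as witnessed by the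
action on `1`. -/
theorem ratB_apply_one_injective {p m n : ℕ} (hp : p ≠ 0)
    (ρ : RatB p m n →ₐ[ℚ]
      Module.End (MvPolynomial (Fin n) ℚ) (MvPolynomial (Fin m) (MvPolynomial (Fin n) ℚ)))
    (hX : ∀ i, ρ (ratX p m n i) = LinearMap.mulLeft _ (MvPolynomial.X i))
    (hY : ∀ j, ρ (ratY p m n j) 1 = MvPolynomial.C (MvPolynomial.X j))
    {z w : RatB p m n} (h : ρ z 1 = ρ w 1) : z = w := by
  rw [← sub_eq_zero]
  have h : ρ (z - w) 1 = 0 := by rw [map_sub, LinearMap.sub_apply, h, sub_self]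
  generalize z - w = z at h
  have hz : z ∈ Submodule.span ℚ (Set.range fun e : (Fin m → ℕ) × (Fin n → ℕ) =>
      normalMonomial (ratX p m n) (ratY p m n) e.1 e.2) := by
    rw [ratB_span_normalMonomial hp]; trivial
  obtain ⟨l, rfl⟩ := Finsupp.mem_span_range_iff_exists_finsupp.1 hz
  have hl := linearIndependent_iff.1 (MvPolynomial.linearIndependent_prod_pow_mul (m := m) (n := n))
    l (by
      rw [← h, Finsupp.linearCombination_apply, Finsupp.sum, Finsupp.sum, map_sum,
        LinearMap.sum_apply]
      refine Finset.sum_congr rfl fun e _ => ?_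
      rw [map_smul, LinearMap.smul_apply]
      congr 1
      have := map_normalMonomial (B := Module.End (MvPolynomial (Fin n) ℚ)
        (MvPolynomial (Fin m) (MvPolynomial (Fin n) ℚ))) ρ.toRingHom (ratX p m n) (ratY p m n) e.1 e.2
      refine Eq.trans ?_ (congrArg (fun T => T 1) this).symm
      have hX' : (fun q => ρ.toRingHom (ratX p m n q)) = fun q =>
          LinearMap.mulLeft (MvPolynomial (Fin n) ℚ) (MvPolynomial.X q) := funext hX
      rw [hX']
      exact (MvPolynomial.normalMonomial_apply_one _ hY _ _).symm)
  rw [hl, Finsupp.sum_zero_index]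

theorem MvPolynomial.mulLeft_natCast_pow {σ k : Type*} [CommRing k] (p r : ℕ) :
    LinearMap.mulLeft k ((p : MvPolynomial σ k) ^ r) =
      (p : Module.End k (MvPolynomial σ k)) ^ r := by
  have h := map_pow (Algebra.lmul k (MvPolynomial σ k)) (p : MvPolynomial σ k) r
  rw [map_natCast] at h
  exact h

/-! ### Representations of the rational algebra and integrality of the commutators -/

namespace WittTranslation

variable (p : ℕ) [hp : Fact p.Prime] {m : ℕ} {k : Type*} [CommRing k] [IsDomain k] [CharZero k]

omit [IsDomain k] [CharZero k] in
theorem op_one (i : ℕ) {d : ℕ} (hd : d ≠ 0) : op p m k i d 1 = 0 := by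
  rw [← map_one MvPolynomial.C, op_C, if_neg hd]

theorem dOp_one (i j : ℕ) : dOp p m k i j 1 = 0 := by
  have h := dOp_apply p (Module.toAddMonoidEnd (Module.End k (MvPolynomial (Fin m) k))
    (MvPolynomial (Fin m) k)) (i := i) (j := j) (v := 1) (fun d hd _ => op_one p i hd.ne')
  exact h.trans (op_one p i (pow_ne_zero j hp.out.ne_zero))

/-- The operators killing `1` form an ideal of the commutative ring `OpAlg`. Modulo it `opWitt 0`
vanishes, so `yWitt y` reduces to the constant vector. -/
theorem yOp_one (y : ℕ → k) (j : ℕ) : yOp p m y j 1 = MvPolynomial.C (y j) := by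
  let I : Ideal (OpAlg p m k) :=
    { carrier := {T | opVal p m k T 1 = 0}
      add_mem' := fun {a b} ha hb => by
        change opVal p m k (a + b) 1 = 0
        rw [map_add, LinearMap.add_apply, show opVal p m k a 1 = 0 from ha,
          show opVal p m k b 1 = 0 from hb, add_zero]
      zero_mem' := by
        change opVal p m k 0 1 = 0
        rw [map_zero, LinearMap.zero_apply]
      smul_mem' := fun a b hb => by
        change opVal p m k (a * b) 1 = 0
        rw [map_mul, Module.End.mul_apply, show opVal p m k b 1 = 0 from hb, map_zero] }
  have hD : WittVector.map (Ideal.Quotient.mk I) (opWitt p m k 0) = 0 := by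
    ext l
    rw [WittVector.map_coeff, WittVector.zero_coeff, Ideal.Quotient.eq_zero_iff_mem]
    exact dOp_one p 0 l
  have hY : WittVector.map (Ideal.Quotient.mk I) (yWitt (m := m) p y) =
      WittVector.map (Ideal.Quotient.mk I) (WittVector.map (algebraMap k (OpAlg p m k))
        (WittVector.mk p y)) := by
    rw [yWitt, map_add, hD, zero_add]
  have h := congrArg (fun x => WittVector.coeff x j) hY
  simp only [WittVector.map_coeff, WittVector.coeff_mk] at h
  have h : opVal p m k ((yWitt (m := m) p y).coeff j - algebraMap k (OpAlg p m k) (y j)) 1 = 0 :=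
    Ideal.Quotient.eq.1 h
  rw [map_sub, AlgHom.commutes, LinearMap.sub_apply, sub_eq_zero] at h
  refine h.trans ?_
  rw [Module.algebraMap_end_apply, MvPolynomial.smul_eq_C_mul, mul_one]

open MvPolynomial in
-- Only the ghost components of `Y` matter for the mixed relations, and there the scalars `γ` drop
-- out of every commutator.
theorem exists_ratB_rep {k' : Type*} [CommRing k'] [Algebra k k'] [Algebra ℚ k'] {a b : ℕ}
    (ham : a ≤ m) (Y : Fin b → Module.End k' (MvPolynomial (Fin m) k')) (γ : Fin b → k')
    (hY : ∀ r s, Commute (Y r) (Y s))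
    (hg : ∀ r, ghostComp p Y r = endShift 0 (ghostDeriv p m k r) +
      algebraMap k' (Module.End k' (MvPolynomial (Fin m) k')) (γ r)) :
    ∃ ρ : RatB p a b →ₐ[ℚ] Module.End k' (MvPolynomial (Fin m) k'),
      (∀ q, ρ (ratX p a b q) = LinearMap.mulLeft k' (X (q.castLE ham))) ∧
      ∀ r, ρ (ratY p a b r) = Y r := by
  have hlmul : ∀ f g : MvPolynomial (Fin m) k', LinearMap.mulLeft k' f * LinearMap.mulLeft k' g =
      LinearMap.mulLeft k' (f * g) := fun f g => (LinearMap.mulLeft_mul k' _ f g).symm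
  refine exists_ratB_lift (p := p) _ Y (fun q r => ?_) hY fun q r => ?_
  · rw [Commute, SemiconjBy, hlmul, hlmul, mul_comm]
  · have h1 : ghostComp p (fun q : Fin a => LinearMap.mulLeft k' (X (q.castLE ham) :
        MvPolynomial (Fin m) k')) q =
        endShift 0 (LinearMap.mulLeft k (ghostComp p X (q.castLE ham))) := by
      rw [endShift_mulLeft]
      have h2 := map_ghostComp (p := p) ((Algebra.lmul k' (MvPolynomial (Fin m) k')).toRingHom.comp
        (shiftMap k (0 : Fin m → k')).toRingHom) X (q.castLE ham)
      refine Eq.trans ?_ h2.symm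
      rw [← ghostComp_castLE ham]
      congr 1
      ext1 q
      simp [shiftMap_X]
      rfl
    have h3 : ghostDeriv p m k r * LinearMap.mulLeft k (ghostComp p X (q.castLE ham)) -
        LinearMap.mulLeft k (ghostComp p X (q.castLE ham)) * ghostDeriv p m k r =
        if (q : ℕ) = r then (p : Module.End k (MvPolynomial (Fin m) k)) ^ (q : ℕ) else 0 := by
      have h4 : ghostDeriv p m k r * LinearMap.mulLeft k (ghostComp p X (q.castLE ham)) -
        LinearMap.mulLeft k (ghostComp p X (q.castLE ham)) * ghostDeriv p m k r =
          LinearMap.mulLeft k (ghostDeriv p m k r (ghostComp p X (q.castLE ham))) :=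
        LinearMap.ext fun f => by
          rw [LinearMap.sub_apply, Module.End.mul_apply, Module.End.mul_apply,
            LinearMap.mulLeft_apply, LinearMap.mulLeft_apply, LinearMap.mulLeft_apply,
            ghostDeriv_mul]
          ring
      rw [h4, ghostDeriv_ghostComp]
      by_cases h : (q : ℕ) = r
      · rw [if_pos h, if_pos (by exact h), mulLeft_natCast_pow, h]
      · rw [if_neg h, if_neg (by exact h), LinearMap.mulLeft_zero_eq_zero]
    rw [h1, hg, add_mul, mul_add, (Algebra.commutes (γ r) _), add_sub_add_right_eq_sub, ← map_mul,
      ← map_mul, ← map_sub, h3]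
    split_ifs
    · rw [map_pow, map_natCast]
    · rw [map_zero]

open MvPolynomial in
theorem endShift_ghost {k' : Type*} [CommRing k'] [Algebra k k'] (α : Fin m → k') (y : ℕ → k)
    {b : ℕ} (r : Fin b) :
    ghostComp p (fun r : Fin b => endShift α (yOp p m y r)) r =
      endShift α (ghostDeriv p m k r) +
        algebraMap k' (Module.End k' (MvPolynomial (Fin m) k')) (algebraMap k k'
          (∑ l ∈ Finset.range (r + 1), (p : k) ^ l * y l ^ p ^ ((r : ℕ) - l))) := by
  rw [← map_ghostComp, ghostComp_eq_sum_range (fun r => yOp p m y r), sum_yOp, map_add,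
    endShift_algebraMap]

open MvPolynomial in
-- The identity holds in the rational algebra, hence in the representation over `k'`; injectivity of
-- `endShift 0` returns it to `k`.
theorem commutator_yOp (k' : Type*) [CommRing k'] [Algebra k k'] [Algebra ℚ k']
    (hinj : Function.Injective (algebraMap k k')) (i : Fin m) (j : ℕ)
    {c : MvPolynomial (Fin i ⊕ Fin j) ℤ} (hc : IsCommutatorPoly p i j c) (y : ℕ → k) :
    yOp p m y j * LinearMap.mulLeft k (X i) - LinearMap.mulLeft k (X i) * yOp p m y j =
      normalEval c (fun q : Fin i => LinearMap.mulLeft k (X (q.castLE i.isLt.le)))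
        (fun r : Fin j => yOp p m y r) := by
  obtain ⟨ρ, hX, hY⟩ := exists_ratB_rep p (k := k) (k' := k') (a := i + 1) (b := j + 1) i.isLt
    (fun r => endShift 0 (yOp p m y r)) _ (fun r s => (commute_yOp p y r s).map (endShift 0))
    (endShift_ghost p 0 y)
  refine endShift_zero_injective (σ := Fin m) hinj ?_
  have h := congrArg ρ hc
  rw [map_sub, map_mul, map_mul, hX, hY] at h
  have hn := map_normalEval (B := Module.End k' (MvPolynomial (Fin m) k')) ρ.toRingHom c
    (fun q => ratX p (i + 1) (j + 1) q.castSucc) (fun r => ratY p (i + 1) (j + 1) r.castSucc)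
  have h := h.trans hn
  rw [map_normalEval, map_sub, map_mul, map_mul, endShift_mulLeft, shiftMap_X]
  simp only [endShift_mulLeft, shiftMap_X, Pi.zero_apply, C_0, add_zero]
  refine Eq.trans h ?_
  congr 1
  · ext1 q; exact hX _
  · ext1 r; exact hY _

open MvPolynomial in
-- The positive coefficients of the translation commute with `yOp` and send the last variable to `0`
-- or `1`; `yOp` sends `1` to `y j = 0`.
theorem translate_yOp_X {i : ℕ} (y : ℕ → k) {j : ℕ} (hy : y j = 0) :
    translate p (i + 1) k i (yOp p (i + 1) y j (X (Fin.last i))) =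
      Polynomial.C (yOp p (i + 1) y j (X (Fin.last i))) := by
  ext1 d
  rw [← op_apply, Polynomial.coeff_C]
  split_ifs with hd
  · rw [hd, op_zero, Module.End.one_apply]
  · have h := congrArg (fun T => T (X (Fin.last i))) (commute_op_yOp (m := i + 1) p y i d j).eq
    refine h.trans ?_
    change yOp p (i + 1) y j (op p (i + 1) k i d (X (Fin.last i))) = 0
    have hX := translate_X_self (k := k) p (Fin.last i)
    rw [Fin.val_last] at hX
    rw [op_apply, hX, Polynomial.coeff_add, Polynomial.coeff_C, if_neg hd, zero_add,
      Polynomial.coeff_X]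
    split_ifs
    · rw [yOp_one, hy, C_0]
    · rw [map_zero]

open MvPolynomial in
/-- A polynomial which is invariant under the translations of its last variable does not involve
this variable. -/
theorem rename_castSucc_of_translate {i : ℕ} {f : MvPolynomial (Fin (i + 1)) k}
    (hf : translate p (i + 1) k i f = Polynomial.C f) :
    rename Fin.castSucc (aeval (Fin.lastCases 0 X : Fin (i + 1) → MvPolynomial (Fin i) k) f) = f := by
  -- Putting `t = -X_i` in the translation sets the last variable `X_i` to zero and fixes the
  -- others.
  have h : (rename Fin.castSucc).comp
      (aeval (Fin.lastCases 0 X : Fin (i + 1) → MvPolynomial (Fin i) k)) =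
      ((Polynomial.aeval (-X (Fin.last i) : MvPolynomial (Fin (i + 1)) k)).restrictScalars k).comp
        (translate p (i + 1) k i) := by
    refine algHom_ext fun q => ?_
    refine Fin.lastCases ?_ (fun q => ?_) q
    · have hX := translate_X_self (k := k) p (Fin.last i)
      rw [Fin.val_last] at hX
      simp [hX]
    · have hX := translate_X_of_lt (k := k) p i q.castSucc q.isLt
      simp [hX]
  have h := congrArg (fun φ => φ f) h
  refine h.trans ?_
  simp [hf]

end WittTranslation

open MvPolynomial WittTranslation in
theorem exists_isCommutatorPoly (p : ℕ) [Fact p.Prime] (i j : ℕ) : ∃ c, IsCommutatorPoly p i j c := by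
  let k := MvPolynomial (Fin j) ℤ
  let k' := MvPolynomial (Fin (j + 1)) ℚ
  let _ : Algebra k k' := (aeval (R := ℤ) (fun r : Fin j => (X r.castSucc : k'))).toRingHom.toAlgebra
  have hk : ∀ r : Fin j, algebraMap k k' (X r) = X r.castSucc := fun r =>
    aeval_X (R := ℤ) (fun r : Fin j => (X r.castSucc : k')) r
  let y : ℕ → k := fun l => if h : l < j then X ⟨l, h⟩ else 0
  have hyj : y j = 0 := dif_neg (lt_irrefl j)
  let T : ℕ → Module.End k' (MvPolynomial (Fin (i + 1)) k') :=
    fun r => endShift 0 (yOp p (i + 1) y r)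
  -- The integral operators are built with `y_j = 0`. The variable `y_j` is added afterwards as a
  -- scalar, which cancels in the commutator with `x_i`.
  let δ : Fin (j + 1) → k' := fun r => if r = Fin.last j then X r else 0
  let Y : Fin (j + 1) → Module.End k' (MvPolynomial (Fin (i + 1)) k') :=
    fun r => T r + algebraMap k' _ (δ r)
  have hT1 : ∀ l, T l 1 = C (algebraMap k k' (y l)) := fun l => by
    have h := endShift_apply (0 : Fin (i + 1) → k') (yOp p (i + 1) y l) 1
    rw [map_one, yOp_one] at h
    refine h.trans ?_
    simp [shiftMap, MvPolynomial.algebraMap_apply]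
  have hY1 : ∀ r, Y r 1 = C (X r) := fun r => by
    rw [LinearMap.add_apply, hT1, Module.algebraMap_end_apply, smul_eq_C_mul, mul_one, ← C_add]
    congr 1
    refine Fin.lastCases ?_ (fun r => ?_) r
    · simp [δ, hyj]
    · have h1 : y (r.castSucc : Fin (j + 1)) = X r := dif_pos r.isLt
      rw [h1, hk]
      simp [δ, (Fin.castSucc_lt_last r).ne]
  obtain ⟨ρ, hρX, hρY⟩ := exists_ratB_rep p (k := k) (k' := k') (a := i + 1) (b := j + 1) le_rfl
    Y (fun r => algebraMap k k' (∑ l ∈ Finset.range ((r : ℕ) + 1), (p : k) ^ l *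
      y l ^ p ^ ((r : ℕ) - l)) + (p : k') ^ (r : ℕ) * δ r)
    (fun r s => ((((commute_yOp p y r s).map (endShift 0)).add_right
      (Algebra.commute_algebraMap_right _ _)).add_left (Algebra.commute_algebraMap_left _ _)))
    (fun r => by
      have h := endShift_ghost (k' := k') p (0 : Fin (i + 1) → k') y r
      -- Only the last coordinate is changed, and it enters its own ghost component linearly, with
      -- factor `p^j`.
      rw [ghostComp_eq_add] at h ⊢
      rw [map_add, map_mul, map_pow, map_natCast, ← add_assoc, ← h, mul_add,
        Finset.sum_congr rfl fun l hl => ?_]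
      · abel
      · have : Y l = T l := by
          have : δ l = 0 := if_neg ((Finset.mem_filter.1 hl).2.trans_le (Fin.le_last r)).ne
          simp only [Y, this, map_zero, add_zero]
        rw [this])
  -- Applied to `1`, the commutator gives `yOp` of the last variable. This is integral, involves no
  -- `y_j`, and by translation invariance no `x_i`.
  let c₁ : MvPolynomial (Fin i) k :=
    aeval (Fin.lastCases 0 X : Fin (i + 1) → MvPolynomial (Fin i) k)
      (yOp p (i + 1) y j (X (Fin.last i)))
  have hc₁ : rename Fin.castSucc c₁ = yOp p (i + 1) y j (X (Fin.last i)) :=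
    rename_castSucc_of_translate p (translate_yOp_X p y hyj)
  refine ⟨(sumAlgEquiv ℤ (Fin i) (Fin j)).symm c₁, ?_⟩
  refine ratB_apply_one_injective (Fact.out : p.Prime).ne_zero ρ hρX
    (fun r => by rw [hρY, hY1]) ?_
  have hn := map_normalEval (B := Module.End k' (MvPolynomial (Fin (i + 1)) k')) ρ.toRingHom
    ((sumAlgEquiv ℤ (Fin i) (Fin j)).symm c₁) (fun q => ratX p (i + 1) (j + 1) q.castSucc)
    (fun r => ratY p (i + 1) (j + 1) r.castSucc)
  have hX' : (fun q : Fin i => ρ.toRingHom (ratX p (i + 1) (j + 1) q.castSucc)) =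
      fun q => LinearMap.mulLeft k' (X q.castSucc) := funext fun q => hρX _
  have hY' : (fun r : Fin j => ρ.toRingHom (ratY p (i + 1) (j + 1) r.castSucc)) =
      fun r => Y r.castSucc := funext fun r => hρY _
  rw [hX', hY'] at hn
  have hR := congrArg (fun T => T 1) hn
  rw [normalEval_apply_one _ _ (fun r => hY1 r.castSucc)] at hR
  refine Eq.trans ?_ hR.symm
  have hring : ((aeval (R := ℤ) (Sum.elim (fun q : Fin i => (X q.castSucc :
      MvPolynomial (Fin (i + 1)) k')) fun r : Fin j => C (X r.castSucc))).toRingHom.comp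
      (sumAlgEquiv ℤ (Fin i) (Fin j)).symm.toAlgHom.toRingHom) =
      (shiftMap k (0 : Fin (i + 1) → k')).toRingHom.comp
        (rename (R := k) (Fin.castSucc (n := i))).toRingHom := by
    refine ringHom_ext (fun a => ?_) fun q => ?_
    · have : ((((aeval (R := ℤ) (Sum.elim (fun q : Fin i => (X q.castSucc :
          MvPolynomial (Fin (i + 1)) k')) fun r : Fin j => C (X r.castSucc))).toRingHom.comp
          (sumAlgEquiv ℤ (Fin i) (Fin j)).symm.toAlgHom.toRingHom)).comp C) =
          ((shiftMap k (0 : Fin (i + 1) → k')).toRingHom.comp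
            (rename (R := k) (Fin.castSucc (n := i))).toRingHom).comp C := by
        refine ringHom_ext (fun a => by simp) fun r => ?_
        simp [sumAlgEquiv_symm_C_X, shiftMap, MvPolynomial.algebraMap_apply, hk]
      exact congrArg (fun φ => φ a) this
    · simp [sumAlgEquiv_symm_X, shiftMap]
  have h1 := (congrArg (fun φ => φ c₁) hring)
  refine Eq.trans ?_ h1.symm
  change _ = shiftMap k (0 : Fin (i + 1) → k') (rename Fin.castSucc c₁)
  rw [hc₁, ← endShift_apply, shiftMap_X, map_sub, map_mul, map_mul, hρX, hρY, LinearMap.sub_apply,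
    Module.End.mul_apply, Module.End.mul_apply, LinearMap.mulLeft_apply, LinearMap.mulLeft_apply,
    hY1, mul_one]
  change (T j + algebraMap k' _ (δ (Fin.last j))) _ - _ = _
  rw [LinearMap.add_apply, Module.algebraMap_end_apply, smul_eq_C_mul]
  simp [δ, T]
  ring

/-! ### Truncated polynomials and their endomorphisms -/

namespace MvPolynomial

variable {L : Type*} {m N : ℕ}

/-- The exponent of a monomial in which every variable occurs less than `N` times. -/
noncomputable def boxExp (γ : Fin m → Fin N) : Fin m →₀ ℕ :=
  Finsupp.equivFunOnFinite.symm fun l => (γ l : ℕ)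

theorem boxExp_apply (γ : Fin m → Fin N) (l : Fin m) : boxExp γ l = γ l := rfl

theorem boxExp_injective : Function.Injective (boxExp : (Fin m → Fin N) → _) := fun γ γ' h =>
  _root_.funext fun l => Fin.ext <| by
    have h : boxExp γ l = boxExp γ' l := by rw [h]
    exact h

variable [Field L]

variable (L m N) in
/-- The reduction modulo the ideal of the `X_l ^ N`, in coordinates. -/
noncomputable def trunc : MvPolynomial (Fin m) L →ₗ[L] ((Fin m → Fin N) → L) :=
  LinearMap.pi fun γ => lcoeff L (boxExp γ)

theorem trunc_apply (f : MvPolynomial (Fin m) L) (γ : Fin m → Fin N) :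
    trunc L m N f γ = f.coeff (boxExp γ) := rfl

variable (L m N) in
/-- The section of `trunc` with values in the polynomials of degree less than `N` in every
variable. -/
noncomputable def untrunc : ((Fin m → Fin N) → L) →ₗ[L] MvPolynomial (Fin m) L :=
  Fintype.linearCombination L fun γ => monomial (boxExp γ) 1

theorem trunc_untrunc (v : (Fin m → Fin N) → L) : trunc L m N (untrunc L m N v) = v := by
  ext γ
  simp [trunc_apply, untrunc, Fintype.linearCombination_apply, coeff_sum, coeff_monomial,
    boxExp_injective.eq_iff]

theorem trunc_eq_zero_iff {f : MvPolynomial (Fin m) L} :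
    trunc L m N f = 0 ↔ f ∈ Ideal.span (Set.range fun l : Fin m => (X l : MvPolynomial _ L) ^ N) := by
  have hs : (Set.range fun l : Fin m => (X l : MvPolynomial (Fin m) L) ^ N) =
      (fun s => monomial s 1) '' Set.range fun l : Fin m => Finsupp.single l N := by
    rw [← Set.range_comp]
    congr 1
    ext1 l
    exact X_pow_eq_monomial
  rw [hs, mem_ideal_span_monomial_image]
  constructor
  · intro h ζ hζ
    by_contra! hne
    have hlt : ∀ l, ζ l < N := fun l => by
      have := hne _ ⟨l, rfl⟩
      rw [Finsupp.single_le_iff] at this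
      omega
    have hζ' : boxExp (fun l => (⟨ζ l, hlt l⟩ : Fin N)) = ζ := by ext l; rfl
    have := congrFun h fun l => ⟨ζ l, hlt l⟩
    rw [trunc_apply, hζ'] at this
    exact mem_support_iff.1 hζ this
  · intro h
    ext γ
    by_contra hne
    obtain ⟨_, ⟨l, rfl⟩, hl⟩ := h _ (mem_support_iff.2 hne)
    rw [Finsupp.single_le_iff, boxExp_apply] at hl
    exact absurd (γ l).isLt (by omega)

variable (L m N) in
/-- The operators which are linear over the polynomials in the `X_l ^ N`. -/
noncomputable abbrev powCentralizer : Subalgebra L (Module.End L (MvPolynomial (Fin m) L)) :=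
  Subalgebra.centralizer L
    (Set.range fun l : Fin m => LinearMap.mulLeft L ((X l : MvPolynomial (Fin m) L) ^ N))

theorem trunc_map_eq_zero {T : Module.End L (MvPolynomial (Fin m) L)}
    (hT : T ∈ powCentralizer L m N) {f : MvPolynomial (Fin m) L} (hf : trunc L m N f = 0) :
    trunc L m N (T f) = 0 := by
  rw [trunc_eq_zero_iff] at hf ⊢
  obtain ⟨c, rfl⟩ := (Ideal.mem_span_range_iff_exists_fun).1 hf
  rw [map_sum]
  refine sum_mem fun l _ => ?_
  have h := congrArg (fun U => U (c l)) (hT _ ⟨l, rfl⟩)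
  have h : X l ^ N * T (c l) = T (X l ^ N * c l) := h
  rw [mul_comm (c l), ← h]
  exact Ideal.mul_mem_right _ _ (Ideal.subset_span ⟨l, rfl⟩)

variable (L m N) in
/-- The action of `powCentralizer` on the truncated polynomials. -/
noncomputable def truncEnd :
    powCentralizer L m N →ₐ[L] Module.End L ((Fin m → Fin N) → L) :=
  AlgHom.ofLinearMap
    { toFun := fun T => trunc L m N ∘ₗ (T : Module.End L (MvPolynomial (Fin m) L)) ∘ₗ untrunc L m N
      map_add' := fun T U => by ext; simp
      map_smul' := fun c T => by ext; simp }
    (LinearMap.ext fun v => trunc_untrunc v)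
    (fun T U => LinearMap.ext fun v => by
      change trunc L m N (T.1 (U.1 _)) = trunc L m N (T.1 (untrunc L m N (trunc L m N (U.1 _))))
      rw [← sub_eq_zero, ← map_sub, ← map_sub]
      refine trunc_map_eq_zero T.2 ?_
      rw [map_sub, trunc_untrunc, sub_self])

theorem truncEnd_apply (T : powCentralizer L m N) (f : MvPolynomial (Fin m) L) :
    truncEnd L m N T (trunc L m N f) = trunc L m N (T.1 f) := by
  change trunc L m N (T.1 (untrunc L m N (trunc L m N f))) = _
  rw [← sub_eq_zero, ← map_sub, ← map_sub]
  refine trunc_map_eq_zero T.2 ?_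
  rw [map_sub, trunc_untrunc, sub_self]

theorem mulLeft_mem_powCentralizer (f : MvPolynomial (Fin m) L) :
    LinearMap.mulLeft L f ∈ powCentralizer L m N := by
  rintro _ ⟨l, rfl⟩
  refine LinearMap.ext fun g => ?_
  simp only [Module.End.mul_apply, LinearMap.mulLeft_apply]
  ring

/-- The monomial `∏ X_l ^ (N - 1)` as an exponent. -/
noncomputable def topExp (m N : ℕ) : Fin m →₀ ℕ := Finsupp.equivFunOnFinite.symm fun _ => N - 1

theorem boxExp_le_topExp (γ : Fin m → Fin N) : boxExp γ ≤ topExp m N := fun l =>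
  Nat.le_sub_one_of_lt (γ l).isLt

/-- Every nonconstant monomial times the top one is divisible by some `X_l ^ N`. -/
theorem trunc_topExp_mul (f : MvPolynomial (Fin m) L) :
    trunc L m N (monomial (topExp m N) 1 * f) =
      trunc L m N (constantCoeff f • monomial (topExp m N) 1) := by
  ext γ
  rw [trunc_apply, trunc_apply, coeff_monomial_mul', coeff_smul, coeff_monomial]
  by_cases h : topExp m N = boxExp γ
  · simp [h, constantCoeff_eq]
  · rw [if_neg fun h' => h (le_antisymm h' (boxExp_le_topExp γ)), if_neg h, smul_zero]

/-- The truncated polynomial algebra is a Frobenius algebra: every nonzero element has a multiple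
which is a nonzero multiple of the monomial of top degree. -/
theorem exists_trunc_mul_eq {f : MvPolynomial (Fin m) L} (hf : trunc L m N f ≠ 0) :
    ∃ (g : MvPolynomial (Fin m) L) (c : L), c ≠ 0 ∧
      trunc L m N (g * f) = trunc L m N (c • monomial (topExp m N) 1) := by
  classical
  let s : Finset (Fin m → Fin N) := Finset.univ.filter fun γ => trunc L m N f γ ≠ 0
  have hs : s.Nonempty := by
    obtain ⟨γ, hγ⟩ := Function.ne_iff.1 hf
    exact ⟨γ, Finset.mem_filter.2 ⟨Finset.mem_univ _, hγ⟩⟩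
  -- Take a monomial of least total degree in `f` and multiply by its complement. A surviving
  -- exponent other than the top one would come from an exponent of `f` below `γ` in every entry,
  -- hence equal to `γ` by minimality.
  obtain ⟨γ, hγ, hmin⟩ := s.exists_min_image (fun γ => ∑ l, (γ l : ℕ)) hs
  refine ⟨monomial (topExp m N - boxExp γ) 1, trunc L m N f γ, (Finset.mem_filter.1 hγ).2, ?_⟩
  ext ζ
  rw [trunc_apply, trunc_apply, coeff_monomial_mul', coeff_smul, coeff_monomial, one_mul]
  have hle : ∀ l, (ζ l : ℕ) ≤ N - 1 := fun l => boxExp_le_topExp ζ l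
  have hleγ : ∀ l, (γ l : ℕ) ≤ N - 1 := fun l => boxExp_le_topExp γ l
  by_cases htop : topExp m N = boxExp ζ
  · rw [if_pos htop, ← htop, if_pos tsub_le_self,
      tsub_tsub_cancel_of_le (boxExp_le_topExp γ), smul_eq_mul, mul_one, trunc_apply]
  · rw [if_neg htop, smul_zero]
    split_ifs with h
    · have hlt : ∀ l, (boxExp ζ - (topExp m N - boxExp γ)) l < N := fun l =>
        (Nat.sub_le _ _).trans_lt (ζ l).isLt
      by_contra hne
      have hζ : boxExp (fun l => (⟨_, hlt l⟩ : Fin N)) = boxExp ζ - (topExp m N - boxExp γ) := by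
        ext l; rfl
      have hmem : (fun l => (⟨_, hlt l⟩ : Fin N)) ∈ s := by
        refine Finset.mem_filter.2 ⟨Finset.mem_univ _, ?_⟩
        rw [trunc_apply, hζ]
        exact hne
      have hsum := hmin _ hmem
      have hval : ∀ l, ((boxExp ζ - (topExp m N - boxExp γ)) l : ℕ) = ζ l - (N - 1 - γ l) :=
        fun l => rfl
      have hle' : ∀ l, (boxExp ζ - (topExp m N - boxExp γ)) l ≤ (γ l : ℕ) := fun l => by
        have := h l
        have h' : N - 1 - (γ l : ℕ) ≤ ζ l := this
        have := hle l
        rw [hval]; omega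
      have heq := (Finset.sum_eq_sum_iff_of_le fun l _ => hle' l).1
        (le_antisymm (Finset.sum_le_sum fun l _ => hle' l) hsum)
      refine htop ?_
      ext l
      have h1 := heq l (Finset.mem_univ l)
      have h' : N - 1 - (γ l : ℕ) ≤ ζ l := h l
      have := hle l
      have := hleγ l
      rw [hval] at h1
      change N - 1 = (ζ l : ℕ)
      omega
    · rfl

/-- An algebra of operators which contains all multiplications and an operator `θ` mapping the
monomial of top degree to a nonzero constant acts on the truncated polynomials as the full
endomorphism algebra. -/
theorem eq_top_of_topExp (hN : 0 < N) {S : Subalgebra L (Module.End L (MvPolynomial (Fin m) L))}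
    (hS : S ≤ powCentralizer L m N) (hmul : ∀ f, LinearMap.mulLeft L f ∈ S)
    {θ : Module.End L (MvPolynomial (Fin m) L)} (hθS : θ ∈ S) {c : L} (hc : c ≠ 0)
    (hθ : θ (monomial (topExp m N) 1) = C c)
    {A : Subalgebra L (Module.End L ((Fin m → Fin N) → L))}
    (hA : ∀ T (hT : T ∈ S), truncEnd L m N ⟨T, hS hT⟩ ∈ A) : A = ⊤ := by
  have hconst : ∀ {f : MvPolynomial (Fin m) L}, trunc L m N f = 0 → constantCoeff f = 0 :=
    fun {f} hf => by
      have h0 : boxExp (fun _ : Fin m => (⟨0, hN⟩ : Fin N)) = 0 := by ext l; rfl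
      have := congrFun hf fun _ => ⟨0, hN⟩
      rwa [trunc_apply, h0] at this
  -- The functionals all of whose rank one operators lie in `A`; the goal is that every functional
  -- does.
  let W : Submodule L (Module.Dual L ((Fin m → Fin N) → L)) :=
    { carrier := {μ | ∀ v, LinearMap.smulRight μ v ∈ A}
      add_mem' := fun {μ ν} hμ hν v => by
        have : LinearMap.smulRight (μ + ν) v = LinearMap.smulRight μ v + LinearMap.smulRight ν v :=
          LinearMap.ext fun w => add_smul _ _ _
        rw [this]
        exact add_mem (hμ v) (hν v)
      zero_mem' := fun v => by
        have : LinearMap.smulRight (0 : Module.Dual L ((Fin m → Fin N) → L)) v = 0 :=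
          LinearMap.ext fun w => zero_smul _ _
        rw [this]
        exact zero_mem A
      smul_mem' := fun a μ hμ v => by
        have : LinearMap.smulRight (a • μ) v = a • LinearMap.smulRight μ v := by
          ext; simp [mul_assoc]
        rw [this]; exact A.smul_mem (hμ v) a }
  let κ : MvPolynomial (Fin m) L → Module.Dual L ((Fin m → Fin N) → L) := fun g =>
    lcoeff L 0 ∘ₗ θ ∘ₗ LinearMap.mulLeft L g ∘ₗ untrunc L m N
  have hκ : ∀ g v, κ g v = constantCoeff (θ (g * untrunc L m N v)) := fun g v => rfl
  have hκW : ∀ g, κ g ∈ W := by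
    intro g
    have : c • κ g ∈ W := by
      intro v
      -- Multiplication by the top monomial retains only the constant term of `θ(g w)`; the outer
      -- `θ` turns the top monomial into `c`, and the last factor into a multiple of `v`.
      have hU := hA _ (mul_mem (mul_mem (mul_mem (mul_mem (hmul (untrunc L m N v)) hθS)
        (hmul (monomial (topExp m N) 1))) hθS) (hmul g))
      convert hU using 1
      refine LinearMap.ext fun w => ?_
      conv_rhs => rw [← trunc_untrunc w, truncEnd_apply]
      simp only [Module.End.mul_apply, LinearMap.mulLeft_apply]
      set u := θ (g * untrunc L m N w) with hu
      have h1 : trunc L m N (monomial (topExp m N) 1 * u -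
          constantCoeff u • monomial (topExp m N) 1) = 0 := by
        rw [map_sub, trunc_topExp_mul, sub_self]
      have h2 := trunc_map_eq_zero (mulLeft_mem_powCentralizer (untrunc L m N v))
        (trunc_map_eq_zero (hS hθS) h1)
      rw [LinearMap.mulLeft_apply, map_sub, map_smul, hθ, mul_sub, map_sub, sub_eq_zero] at h2
      rw [h2, LinearMap.smulRight_apply, LinearMap.smul_apply, hκ, ← hu, mul_smul_comm,
        mul_comm (untrunc L m N v), ← smul_eq_C_mul, map_smul, map_smul, trunc_untrunc, smul_smul,
        smul_eq_mul, mul_comm]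
    have := W.smul_mem c⁻¹ this
    rwa [smul_smul, inv_mul_cancel₀ hc, one_smul] at this
  -- By duality it suffices that no nonzero `v` is killed by all `κ g`. The Frobenius property gives
  -- `g` with `g v` a nonzero multiple of the top monomial, which `θ` maps to a nonzero constant.
  have hW : W = ⊤ := by
    rw [← Subspace.dualCoannihilator_dualAnnihilator_eq (W := W)]
    have : W.dualCoannihilator = ⊥ := by
      rw [eq_bot_iff]
      intro v hv
      rw [Submodule.mem_dualCoannihilator] at hv
      by_contra hne
      have hne' : trunc L m N (untrunc L m N v) ≠ 0 := by rwa [trunc_untrunc]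
      obtain ⟨g, d, hd, hg⟩ := exists_trunc_mul_eq hne'
      have h1 := hv _ (hκW g)
      rw [hκ] at h1
      have h2 := hconst (trunc_map_eq_zero (hS hθS)
        (f := g * untrunc L m N v - d • monomial (topExp m N) 1) (by rw [map_sub, hg, sub_self]))
      rw [map_sub, map_sub, h1, map_smul, hθ, zero_sub, neg_eq_zero, smul_eq_C_mul, ← C_mul,
        constantCoeff_C] at h2
      exact mul_ne_zero hd hc h2
    rw [this, Submodule.dualAnnihilator_bot]
  refine eq_top_iff.2 fun T _ => ?_
  have hT : T = ∑ γ, LinearMap.smulRight (LinearMap.proj γ ∘ₗ T) (Pi.single γ 1) := by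
    refine LinearMap.ext fun v => ?_
    ext ζ
    simp [LinearMap.sum_apply, Finset.sum_apply, Pi.single_apply]
  rw [hT]
  refine sum_mem fun γ _ => ?_
  have : LinearMap.proj γ ∘ₗ T ∈ W := hW ▸ Submodule.mem_top
  exact this _

end MvPolynomial

/-! ### Reduction to characteristic `p` -/

namespace WittTranslation

open MvPolynomial

theorem natCast_end_eq_zero (p m : ℕ) (L : Type*) [Field L] [CharP L p] :
    (p : Module.End L (MvPolynomial (Fin m) L)) = 0 := by
  rw [← map_natCast (algebraMap L (Module.End L (MvPolynomial (Fin m) L))), CharP.cast_eq_zero,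
    map_zero]

/-- The factors are congruent to `-(t + 1)` modulo `p`, with `t < p - 1`. -/
theorem cast_descFactorial_ne_zero (p : ℕ) [hp : Fact p.Prime] (L : Type*) [Field L] [CharP L p]
    {r : ℕ} (hr : r ≠ 0) :
    (((p ^ r - 1).descFactorial (p - 1) : ℕ) : L) ≠ 0 := by
  rw [Ne, CharP.cast_eq_zero_iff L p, Nat.descFactorial_eq_prod_range,
    hp.out.prime.dvd_finsetProd_iff]
  rintro ⟨t, ht, hdvd⟩
  have ht := Finset.mem_range.1 ht
  have h1 : p ≤ p ^ r := Nat.le_self_pow hr p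
  have h2 : p ∣ p ^ r - (p ^ r - 1 - t) := Nat.dvd_sub (dvd_pow_self p hr) hdvd
  have := Nat.le_of_dvd (by omega) h2
  omega

variable (p : ℕ) [hp : Fact p.Prime] {m : ℕ} (k : Type*) [CommRing k] {L : Type*}
  [Field L] [Algebra k L] (α : Fin m → L)

/-- The translation by `V^i [t]` in the Witt coordinates `X_l + α_l`. -/
noncomputable def translateShift (i : ℕ) :
    MvPolynomial (Fin m) L →ₐ[L] Polynomial (MvPolynomial (Fin m) L) :=
  aeval fun l => (translate p m k i (X l)).map (shiftMap k α : _ →+* MvPolynomial (Fin m) L) -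
    Polynomial.C (C (α l))

theorem translateShift_shiftMap (i : ℕ) (f : MvPolynomial (Fin m) k) :
    translateShift p k α i (shiftMap k α f) =
      (translate p m k i f).map (shiftMap k α : _ →+* MvPolynomial (Fin m) L) := by
  have h : (translateShift p k α i : _ →+* Polynomial (MvPolynomial (Fin m) L)).comp
      (shiftMap k α : _ →+* MvPolynomial (Fin m) L) =
      (Polynomial.mapRingHom (shiftMap k α : _ →+* MvPolynomial (Fin m) L)).comp
        (translate p m k i).toRingHom := by
    refine ringHom_ext (fun c => ?_) fun l => ?_
    · have h1 : shiftMap k α (C c) = C (algebraMap k L c) := (shiftMap k α).commutes c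
      have h2 : translate p m k i (C c) = Polynomial.C (C c) := (translate p m k i).commutes c
      have h3 : translateShift p k α i (C (algebraMap k L c)) =
        Polynomial.C (C (algebraMap k L c)) := (translateShift p k α i).commutes _
      simp [h1, h2, h3]
    · have h3 : translateShift p k α i (C (α l)) = Polynomial.C (C (α l)) :=
        (translateShift p k α i).commutes _
      simp only [RingHom.comp_apply, RingHom.coe_coe, shiftMap_X, map_add, h3,
        Polynomial.coe_mapRingHom]
      rw [translateShift, aeval_X, sub_add_cancel]
      rfl
  exact congrArg (fun φ => φ f) h

theorem endShift_op_apply {k : Type*} [CommRing k] [Algebra k L] (i d : ℕ)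
    (g : MvPolynomial (Fin m) L) :
    endShift α (op p m k i d) g = (translateShift p k α i g).coeff d := by
  have : endShift α (op p m k i d) =
      ((Polynomial.lcoeff (MvPolynomial (Fin m) L) d).restrictScalars L) ∘ₗ
        (translateShift p k α i).toLinearMap := by
    refine end_ext_shift (k := k) α fun f => ?_
    rw [endShift_apply, op_apply]
    change _ = ((translateShift p k α i) (shiftMap k α f)).coeff d
    rw [translateShift_shiftMap, Polynomial.coeff_map]
    rfl
  rw [this]
  rfl

variable [IsDomain k] [CharZero k]

theorem translateShift_X_of_lt {i : ℕ} (l : Fin m) (hl : (l : ℕ) < i) :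
    translateShift p k α i (X l) = Polynomial.C (X l) := by
  rw [translateShift, aeval_X, translate_X_of_lt p i l hl, Polynomial.map_C]
  simp [shiftMap_X]

theorem translateShift_X_self (i : Fin m) :
    translateShift p k α i (X i) = Polynomial.C (X i) + Polynomial.X := by
  rw [translateShift, aeval_X, translate_X_self]
  simp only [Polynomial.map_add, Polynomial.map_C, Polynomial.map_X, RingHom.coe_coe, shiftMap_X,
    map_add]
  ring

variable {k}

theorem X_dvd_translateShift_sub (i : ℕ) (g : MvPolynomial (Fin m) L) :
    Polynomial.X ∣ translateShift p k α i g - Polynomial.C g := by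
  rw [Polynomial.X_dvd_iff, Polynomial.coeff_sub, ← endShift_op_apply, op_zero, map_one,
    Polynomial.coeff_C_zero, Module.End.one_apply, sub_self]

variable [CharP L p]

/-- The translation sends `X_l` to `X_l + t h`, hence `X_l^{p^n}` to `X_l^{p^n} + t^{p^n} h^{p^n}`,
which is constant below degree `p^n`. -/
theorem endShift_op_mem (i : ℕ) {n d : ℕ} (hd : d < p ^ n) :
    endShift α (op p m k i d) ∈ powCentralizer L m (p ^ n) := by
  rintro _ ⟨l, rfl⟩
  refine LinearMap.ext fun f => ?_
  rw [Module.End.mul_apply, Module.End.mul_apply, LinearMap.mulLeft_apply, LinearMap.mulLeft_apply,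
    endShift_op_apply, endShift_op_apply]
  obtain ⟨h, hh⟩ := X_dvd_translateShift_sub (k := k) p α i (X l)
  rw [map_mul, map_pow, ← sub_add_cancel (translateShift p k α i (X l)) (Polynomial.C (X l)), hh,
    add_pow_char_pow, mul_pow, add_mul, mul_assoc, Polynomial.coeff_add,
    Polynomial.coeff_X_pow_mul', if_neg (by omega), zero_add, ← map_pow, Polynomial.coeff_C_mul]

theorem endShift_yOp_mem (y : ℕ → k) {n j : ℕ} (hj : j < n) :
    endShift α (yOp p m y j) ∈ powCentralizer L m (p ^ n) := by
  refine yOp_mem (S := (powCentralizer L m (p ^ n)).toSubring.comap (endShift α)) p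
    (fun l _ => ?_) fun d hd => ?_
  · change endShift α _ ∈ powCentralizer L m (p ^ n)
    rw [endShift_algebraMap]
    exact algebraMap_mem _ _
  · exact endShift_op_mem p α 0 (hd.trans_lt (Nat.pow_lt_pow_right hp.out.one_lt hj))

/-- Here `(X_i + t)^{p^j M} = (X_i^{p^j} + t^{p^j})^M`. The coefficients in degrees `0 < d < p^j`
vanish, so `dOp_apply` leaves only the one of `t^{p^j}`. -/
theorem endShift_dOp_apply (i : Fin m) (j M : ℕ) {f : MvPolynomial (Fin m) L}
    (hf : translateShift p k α i f = Polynomial.C f) :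
    endShift α (dOp p m k i j) (f * X i ^ (p ^ j * M)) =
      (M : L) • (f * X i ^ (p ^ j * (M - 1))) := by
  have hpos : 0 < p ^ j := pow_pos hp.out.pos j
  have hc : ∀ d, (translateShift p k α i (f * X i ^ (p ^ j * M))).coeff d =
      f * if p ^ j ∣ d then (X i ^ p ^ j) ^ (M - d / p ^ j) * ((M.choose (d / p ^ j) : ℕ) :
        MvPolynomial (Fin m) L) else 0 := by
    intro d
    have h1 : (Polynomial.C (X i) + Polynomial.X : Polynomial (MvPolynomial (Fin m) L)) ^
        (p ^ j * M) = Polynomial.expand _ (p ^ j)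
          ((Polynomial.X + Polynomial.C (X i ^ p ^ j)) ^ M) := by
      rw [pow_mul, add_pow_char_pow, map_pow (Polynomial.expand _ _), map_add, Polynomial.expand_X,
        Polynomial.expand_C, map_pow, add_comm]
    rw [map_mul, map_pow, hf, translateShift_X_self, h1, Polynomial.coeff_C_mul,
      Polynomial.coeff_expand hpos, Polynomial.coeff_X_add_C_pow]
  let φ : Module.End k (MvPolynomial (Fin m) k) →+* AddMonoid.End (MvPolynomial (Fin m) L) :=
    (Module.toAddMonoidEnd (Module.End L (MvPolynomial (Fin m) L))
      (MvPolynomial (Fin m) L)).comp (endShift α)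
  have hφ : ∀ T g, φ T g = endShift α T g := fun T g => rfl
  rw [← hφ, dOp_apply p φ, hφ, endShift_op_apply, hc, if_pos dvd_rfl, Nat.div_self hpos,
    Nat.choose_one_right, ← pow_mul, smul_eq_C_mul, map_natCast]
  · ring
  · intro d h1 h2
    rw [hφ, endShift_op_apply, hc, if_neg fun h => absurd (Nat.le_of_dvd h1 h) (by omega), mul_zero]

theorem endShift_dOp_pow_apply (i : Fin m) (j M s : ℕ) {f : MvPolynomial (Fin m) L}
    (hf : translateShift p k α i f = Polynomial.C f) :
    (endShift α (dOp p m k i j) ^ s) (f * X i ^ (p ^ j * M)) =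
      (M.descFactorial s : L) • (f * X i ^ (p ^ j * (M - s))) := by
  induction s with
  | zero => simp
  | succ s ih =>
    rw [pow_succ', Module.End.mul_apply, ih, map_smul, endShift_dOp_apply p α i j _ hf, smul_smul,
      Nat.descFactorial_succ, Nat.sub_sub, Nat.cast_mul, mul_comm ((_ : ℕ) : L)]

/-- The `(p - 1)`-st power of the `j`-th operator removes the base `p` digit `p - 1` at place `j`
from the exponent `p^n - 1`. -/
theorem exists_killing_variable (n : ℕ) {S : Subalgebra L (Module.End L (MvPolynomial (Fin m) L))}
    (i : Fin m) (hS : ∀ j < n, endShift α (dOp p m k i j) ∈ S) :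
    ∃ T ∈ S, ∃ c : L, c ≠ 0 ∧ ∀ f, translateShift p k α i f = Polynomial.C f →
      T (f * X i ^ (p ^ n - 1)) = c • f := by
  suffices h : ∀ j ≤ n, ∃ T ∈ S, ∃ c : L, c ≠ 0 ∧ ∀ f, translateShift p k α i f = Polynomial.C f →
      T (f * X i ^ (p ^ n - 1)) = c • (f * X i ^ (p ^ j * (p ^ (n - j) - 1))) by
    simpa using h n le_rfl
  intro j hj
  induction j with
  | zero => exact ⟨1, one_mem S, 1, one_ne_zero, by simp⟩
  | succ j ih =>
    obtain ⟨T, hT, c, hc, h⟩ := ih (by omega)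
    refine ⟨_, mul_mem (pow_mem (hS j hj) (p - 1)) hT, _,
      mul_ne_zero hc (cast_descFactorial_ne_zero p L (r := n - j) (by omega)), fun f hf => ?_⟩
    rw [Module.End.mul_apply, h f hf, map_smul, endShift_dOp_pow_apply p α i j _ _ hf, smul_smul]
    congr 3
    obtain ⟨r, rfl⟩ : ∃ r, n = j + 1 + r := ⟨n - (j + 1), by omega⟩
    rw [Nat.add_sub_cancel_left, show j + 1 + r - j = r + 1 by omega, pow_succ p j, mul_assoc]
    congr 1
    have := hp.out.pos
    rw [Nat.mul_sub, mul_one, ← pow_succ']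
    omega

/-- The variables are removed from the last to the first, since the translation by `V^i[t]` fixes
only the `X_l` with `l < i`. -/
theorem exists_topExp (n : ℕ) {S : Subalgebra L (Module.End L (MvPolynomial (Fin m) L))}
    (hS : ∀ (i : Fin m) (j : ℕ), j < n → endShift α (dOp p m k i j) ∈ S) :
    ∃ θ ∈ S, ∃ c : L, c ≠ 0 ∧ θ (monomial (topExp m (p ^ n)) 1) = C c := by
  suffices h : ∀ t ≤ m, ∃ θ ∈ S, ∃ c : L, c ≠ 0 ∧ θ (monomial (topExp m (p ^ n)) 1) =
      c • ∏ l ∈ Finset.univ.filter fun l : Fin m => (l : ℕ) < m - t, X l ^ (p ^ n - 1) by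
    obtain ⟨θ, hθ, c, hc, h⟩ := h m le_rfl
    refine ⟨θ, hθ, c, hc, ?_⟩
    rw [h, Finset.filter_false_of_mem (by simp), Finset.prod_empty, smul_eq_C_mul, mul_one]
  intro t ht
  induction t with
  | zero =>
    refine ⟨1, one_mem S, 1, one_ne_zero, ?_⟩
    rw [one_smul, Module.End.one_apply, Finset.filter_true_of_mem fun l _ => l.isLt,
      monomial_eq, map_one, one_mul, Finsupp.prod_fintype _ _ fun _ => pow_zero _]
    rfl
  | succ t ih =>
    obtain ⟨θ, hθ, c, hc, h⟩ := ih (by omega)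
    let i : Fin m := ⟨m - (t + 1), by omega⟩
    obtain ⟨T, hT, d, hd, hT'⟩ := exists_killing_variable p α n i (hS i)
    refine ⟨_, mul_mem hT hθ, _, mul_ne_zero hc hd, ?_⟩
    have hfil : (Finset.univ.filter fun l : Fin m => (l : ℕ) < m - t) =
        insert i (Finset.univ.filter fun l : Fin m => (l : ℕ) < m - (t + 1)) := by
      ext l
      simp only [Finset.mem_filter, Finset.mem_univ, true_and, Finset.mem_insert, Fin.ext_iff, i]
      omega
    rw [Module.End.mul_apply, h, map_smul, hfil, Finset.prod_insert (by simp [i]), mul_comm,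
      hT', smul_smul]
    rw [map_prod, map_prod]
    refine Finset.prod_congr rfl fun l hl => ?_
    rw [map_pow, map_pow, translateShift_X_of_lt p k α l (Finset.mem_filter.1 hl).2]

theorem endShift_yOp_pow (y : ℕ → k) (j : ℕ) :
    endShift α (yOp p m y j) ^ p ^ m = algebraMap L _ (algebraMap k L (y j) ^ p ^ m) := by
  obtain ⟨T, hT⟩ := yOp_pow (m := m) p y j
  rw [← map_pow, hT, map_add, endShift_algebraMap, map_mul, map_natCast, natCast_end_eq_zero p,
    zero_mul, add_zero, map_pow (algebraMap k L)]

theorem endShift_dOp_pow (i j : ℕ) :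
    endShift α (dOp p m k 0 j) ^ p ^ i = endShift α (dOp p m k i j) := by
  obtain ⟨T, hT⟩ := dOp_pow (m := m) (k := k) p i j
  rw [← map_pow, hT, map_add, map_mul, map_natCast, natCast_end_eq_zero p, zero_mul, add_zero]

variable (n : ℕ)

/-- The operator of multiplication by `X_i + α_i`. -/
noncomputable def shiftX (i : Fin m) : powCentralizer L m (p ^ n) :=
  ⟨LinearMap.mulLeft L (X i + C (α i)), mulLeft_mem_powCentralizer _⟩

/-- The operator obtained from `yOp` by base change. -/
noncomputable def shiftY (y : ℕ → k) (j : Fin n) : powCentralizer L m (p ^ n) :=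
  ⟨endShift α (yOp p m y j), endShift_yOp_mem p α y j.isLt⟩

theorem adjoin_truncEnd_eq_top (y : ℕ → k) :
    Algebra.adjoin L ((Set.range fun i => truncEnd L m (p ^ n) (shiftX p α n i)) ∪
      Set.range fun j => truncEnd L m (p ^ n) (shiftY p α n y j)) = ⊤ := by
  set A := Algebra.adjoin L ((Set.range fun i => truncEnd L m (p ^ n) (shiftX p α n i)) ∪
      Set.range fun j => truncEnd L m (p ^ n) (shiftY p α n y j)) with hA
  -- The operators before truncation whose truncation lies in `A`.
  let S : Subalgebra L (Module.End L (MvPolynomial (Fin m) L)) :=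
    (A.comap (truncEnd L m (p ^ n))).map (powCentralizer L m (p ^ n)).val
  have hX : ∀ i : Fin m, LinearMap.mulLeft L (X i + C (α i)) ∈ S := fun i =>
    ⟨shiftX p α n i, Algebra.subset_adjoin (Or.inl ⟨i, rfl⟩), rfl⟩
  have hY : ∀ j < n, endShift α (yOp p m y j) ∈ S := fun j hj =>
    ⟨shiftY p α n y ⟨j, hj⟩, Algebra.subset_adjoin (Or.inr ⟨⟨j, hj⟩, rfl⟩), rfl⟩
  have hS : S ≤ powCentralizer L m (p ^ n) := by
    rintro _ ⟨T, _, rfl⟩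
    exact T.2
  have hmul : ∀ f, LinearMap.mulLeft L f ∈ S := by
    intro f
    have h : S.comap (Algebra.lmul L (MvPolynomial (Fin m) L)) = ⊤ := by
      rw [eq_top_iff, ← adjoin_range_X, Algebra.adjoin_le_iff]
      rintro _ ⟨i, rfl⟩
      have : X i ∈ S.comap (Algebra.lmul L (MvPolynomial (Fin m) L)) := by
        have h1 : X i + C (α i) ∈ S.comap (Algebra.lmul L (MvPolynomial (Fin m) L)) := hX i
        have h2 := sub_mem h1 (algebraMap_mem _ (α i))
        rwa [algebraMap_eq, add_sub_cancel_right] at h2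
      exact this
    have : f ∈ S.comap (Algebra.lmul L (MvPolynomial (Fin m) L)) := h ▸ Algebra.mem_top
    exact this
  have hD : ∀ (i : Fin m) (j : ℕ), j < n → endShift α (dOp p m k i j) ∈ S := by
    intro i j hj
    -- In characteristic `p` the coordinates of `opWitt i` are powers of those of `opWitt 0`, and
    -- these come from the `y`'s by Witt subtraction.
    rw [← endShift_dOp_pow]
    refine pow_mem ?_ _
    refine dOp_mem (S := S.toSubring.comap (endShift α)) p (y := y) (fun l _ => ?_) fun l hl =>
      hY l (hl.trans_lt hj)
    change endShift α _ ∈ S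
    rw [endShift_algebraMap]
    exact algebraMap_mem _ _
  obtain ⟨θ, hθ, c, hc, h⟩ := exists_topExp p α n hD
  refine eq_top_of_topExp (pow_pos hp.out.pos n) hS hmul hθ hc h ?_
  rintro _ ⟨T, hT, rfl⟩
  exact hT

theorem shiftX_pow (i : Fin m) :
    truncEnd L m (p ^ n) (shiftX p α n i) ^ p ^ n = algebraMap L _ (α i ^ p ^ n) := by
  have h : shiftX p α n i ^ p ^ n = algebraMap L _ (α i ^ p ^ n) +
      ⟨LinearMap.mulLeft L (X i ^ p ^ n), mulLeft_mem_powCentralizer _⟩ := by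
    refine Subtype.ext ?_
    change LinearMap.mulLeft L (X i + C (α i)) ^ p ^ n = algebraMap L _ (α i ^ p ^ n) +
      LinearMap.mulLeft L (X i ^ p ^ n)
    rw [LinearMap.pow_mulLeft, add_pow_char_pow, ← C_pow]
    refine LinearMap.ext fun f => ?_
    rw [LinearMap.add_apply, Module.algebraMap_end_apply, smul_eq_C_mul, LinearMap.mulLeft_apply,
      LinearMap.mulLeft_apply, add_mul, add_comm]
  rw [← map_pow, h, map_add, AlgHom.commutes, add_eq_left]
  refine LinearMap.ext fun v => ?_
  rw [← trunc_untrunc v, truncEnd_apply, LinearMap.mulLeft_apply, LinearMap.zero_apply,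
    trunc_eq_zero_iff]
  exact Ideal.mul_mem_right _ _ (Ideal.subset_span ⟨i, rfl⟩)

theorem shiftY_pow (y : ℕ → k) (j : Fin n) :
    truncEnd L m (p ^ n) (shiftY p α n y j) ^ p ^ m =
      algebraMap L _ (algebraMap k L (y j) ^ p ^ m) := by
  have h : shiftY p α n y j ^ p ^ m = algebraMap L _ (algebraMap k L (y j) ^ p ^ m) :=
    Subtype.ext (endShift_yOp_pow p α y j)
  rw [← map_pow, h, AlgHom.commutes]

theorem commutator_shiftY (k' : Type*) [CommRing k'] [Algebra k k'] [Algebra ℚ k']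
    (hinj : Function.Injective (algebraMap k k')) (y : ℕ → k) (i : Fin m) (j : Fin n) :
    shiftY p α n y j * shiftX p α n i - shiftX p α n i * shiftY p α n y j =
      normalEval (commutatorPoly p i j) (fun q : Fin i => shiftX p α n (q.castLE i.isLt.le))
        (fun r : Fin j => shiftY p α n y (r.castLE j.isLt.le)) := by
  have h := congrArg (endShift α) (commutator_yOp p k' hinj i j
    (Classical.epsilon_spec (exists_isCommutatorPoly p i j)) y)
  rw [map_normalEval, map_sub, map_mul, map_mul] at h
  simp only [endShift_mulLeft, shiftMap_X] at h
  have h' := map_normalEval (B := Module.End L (MvPolynomial (Fin m) L))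
    (powCentralizer L m (p ^ n)).val.toRingHom (commutatorPoly p i j)
    (fun q : Fin i => shiftX p α n (q.castLE i.isLt.le))
    (fun r : Fin j => shiftY p α n y (r.castLE j.isLt.le))
  exact Subtype.ext (h.trans h'.symm)

end WittTranslation

/-- Over a field of characteristic `p` in which `a` and `b` are powers, `A_{((a,b))}` acts on the
truncated polynomial ring, and its image spans the full endomorphism algebra. -/
theorem exists_end_generators (p : ℕ) [hp : Fact p.Prime] (m n : ℕ) {L : Type*} [Field L]
    [CharP L p] (α : Fin m → L) (β : Fin n → L) :
    ∃ (x : Fin m → Module.End L ((Fin m → Fin (p ^ n)) → L))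
      (y : Fin n → Module.End L ((Fin m → Fin (p ^ n)) → L)),
      (∀ i j, Commute (x i) (x j)) ∧ (∀ i j, Commute (y i) (y j)) ∧
      (∀ i j, y j * x i - x i * y j = normalEval (commutatorPoly p i j)
        (fun q : Fin i => x (q.castLE i.isLt.le)) (fun r : Fin j => y (r.castLE j.isLt.le))) ∧
      (∀ i, x i ^ p ^ n = algebraMap L _ (α i ^ p ^ n)) ∧
      (∀ j, y j ^ p ^ m = algebraMap L _ (β j ^ p ^ m)) ∧
      Algebra.adjoin L (Set.range x ∪ Set.range y) = ⊤ := by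
  open WittTranslation MvPolynomial in
  let _ : Algebra (MvPolynomial (Fin n) ℤ) (MvPolynomial (Fin n) ℚ) := algebraMvPolynomial
  -- Ghost arguments need characteristic zero: the operators are built over `ℤ[Y]` with generic
  -- constants and specialized to `β`.
  let _ : Algebra (MvPolynomial (Fin n) ℤ) L := (aeval β : _ →ₐ[ℤ] L).toAlgebra
  have hβ : ∀ j, algebraMap (MvPolynomial (Fin n) ℤ) L (X j) = β j := fun j => aeval_X _ _
  let y : ℕ → MvPolynomial (Fin n) ℤ := fun l => if h : l < n then X ⟨l, h⟩ else 0
  refine ⟨fun i => truncEnd L m (p ^ n) (shiftX p α n i),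
    fun j => truncEnd L m (p ^ n) (shiftY p α n y j), fun i j => Commute.map ?_ _,
    fun i j => Commute.map ?_ _, fun i j => ?_, shiftX_pow p α n, fun j => ?_,
    adjoin_truncEnd_eq_top p α n y⟩
  · refine Subtype.ext (LinearMap.ext fun f => ?_)
    exact mul_left_comm _ _ _
  · exact Subtype.ext ((commute_yOp p y i j).map (endShift α))
  · let φ : powCentralizer L m (p ^ n) →+* Module.End L ((Fin m → Fin (p ^ n)) → L) :=
      (truncEnd L m (p ^ n)).toRingHom
    have h := congrArg φ (commutator_shiftY p α n (MvPolynomial (Fin n) ℚ)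
      (map_injective (algebraMap ℤ ℚ) Int.cast_injective) y i j)
    have h' := map_normalEval φ (commutatorPoly p i j)
      (fun q : Fin i => shiftX p α n (q.castLE i.isLt.le))
      (fun r : Fin j => shiftY p α n y (r.castLE j.isLt.le))
    rw [h', map_sub φ, map_mul φ, map_mul φ] at h
    exact h
  · rw [shiftY_pow, show y j = X j by simp [y], hβ]

/-! ### Descent of centrality and simplicity -/

section Descent

variable {K L A B ι : Type*} [Field K] [Field L] [Algebra K L] [Ring A] [Algebra K A] [Ring B]
  [Algebra K B] [Algebra L B] [IsScalarTower K L B]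

theorem linearIndependent_of_map {φ : A →ₐ[K] B} {e : ι → A}
    (h : LinearIndependent L fun i => φ (e i)) : LinearIndependent K e :=
  LinearIndependent.of_comp φ.toLinearMap (h.restrict_scalars fun r s hrs =>
    (algebraMap K L).injective (by simpa [Algebra.algebraMap_eq_smul_one] using hrs))

theorem exists_extend_scalars {φ : A →ₐ[K] B} (b : Module.Basis ι K A) (c : Module.Basis ι L B)
    (h : ∀ i, c i = φ (b i)) (f : A →ₗ[K] K) :
    ∃ g : B →ₗ[L] L, ∀ z, g (φ z) = algebraMap K L (f z) := by
  refine ⟨c.constr L fun i => algebraMap K L (f (b i)), fun z => ?_⟩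
  have : (((c.constr L fun i => algebraMap K L (f (b i))).restrictScalars K) ∘ₗ φ.toLinearMap) =
      (Algebra.linearMap K L) ∘ₗ f := by
    refine b.ext fun i => ?_
    have := c.constr_basis L (fun i => algebraMap K L (f (b i))) i
    rw [h] at this
    simpa using this
  exact congrArg (fun T => T z) this

theorem map_injective_of_basis {φ : A →ₐ[K] B} (b : Module.Basis ι K A)
    (c : Module.Basis ι L B) (h : ∀ i, c i = φ (b i)) : Function.Injective φ := by
  rw [injective_iff_map_eq_zero]
  intro z hz
  refine b.ext_elem fun i => ?_
  obtain ⟨g, hg⟩ := exists_extend_scalars b c h (b.coord i)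
  have := hg z
  rw [hz, map_zero, eq_comm, map_eq_zero] at this
  simpa using this

theorem Algebra.IsCentral.of_basis [Algebra.IsCentral L B] [Nontrivial B] {φ : A →ₐ[K] B}
    (b : Module.Basis ι K A) (c : Module.Basis ι L B) (h : ∀ i, c i = φ (b i)) :
    Algebra.IsCentral K A := by
  refine ⟨fun z hz => ?_⟩
  have hz := Subalgebra.mem_center_iff.1 hz
  have hc : φ z ∈ Subalgebra.center L B := by
    rw [Subalgebra.mem_center_iff]
    intro w
    have hw : w ∈ Submodule.span L (Set.range c) := c.span_eq ▸ Submodule.mem_top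
    induction hw using Submodule.span_induction with
    | mem w hw =>
      obtain ⟨i, rfl⟩ := hw
      rw [h, ← map_mul, ← map_mul, hz]
    | zero => simp
    | add u v _ _ hu hv => rw [add_mul, mul_add, hu, hv]
    | smul r u _ hu => rw [smul_mul_assoc, mul_smul_comm, hu]
  rw [Algebra.IsCentral.center_eq_bot] at hc
  obtain ⟨l, hl⟩ := Algebra.mem_bot.1 hc
  have h1 : (1 : A) ∉ (⊥ : Submodule K A) := by
    rw [Submodule.mem_bot]
    intro h1
    exact one_ne_zero (by rw [← map_one φ, h1, map_zero] : (1 : B) = 0)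
  obtain ⟨f, hf, -⟩ := Submodule.exists_le_ker_of_notMem h1
  obtain ⟨g, hg⟩ := exists_extend_scalars b c h f
  -- The image of `z` is a scalar `l ∈ L`; a functional with `f 1 ≠ 0` identifies it as `f z / f 1 ∈
  -- K`.
  have h2 : algebraMap K L (f z) = l * algebraMap K L (f 1) := by
    rw [← hg, ← hg, ← hl, Algebra.algebraMap_eq_smul_one, map_smul, map_one φ, smul_eq_mul]
  refine Algebra.mem_bot.2 ⟨f z / f 1, map_injective_of_basis b c h ?_⟩
  rw [AlgHom.commutes, ← hl, IsScalarTower.algebraMap_apply K L B, map_div₀, h2,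
    mul_div_cancel_right₀ _ ((map_ne_zero _).2 hf)]

/-- A functional that kills a proper ideal but not `1` extends to `L`. It then kills the `L`-span of
the image, which is a two-sided ideal containing `1` if the original ideal is nonzero. -/
theorem IsSimpleRing.of_basis [IsSimpleRing B] {φ : A →ₐ[K] B}
    (b : Module.Basis ι K A) (c : Module.Basis ι L B) (h : ∀ i, c i = φ (b i)) :
    IsSimpleRing A := by
  have hinj := map_injective_of_basis b c h
  have : Nontrivial A := φ.toRingHom.domain_nontrivial
  refine ⟨⟨fun I => ?_⟩⟩
  by_contra! hI
  obtain ⟨hbot, htop⟩ := hI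
  have h1 : (1 : A) ∉ I.asIdeal.restrictScalars K := fun h1 =>
    htop ((TwoSidedIdeal.one_mem_iff I).1 (TwoSidedIdeal.mem_asIdeal.1 h1))
  obtain ⟨f, hf, hfI⟩ := Submodule.exists_le_ker_of_notMem h1
  obtain ⟨g, hg⟩ := exists_extend_scalars b c h f
  set J := Submodule.span L (φ '' I) with hJ
  have hspan : ∀ w, w ∈ Submodule.span L (Set.range φ) := fun w => by
    have hw : w ∈ Submodule.span L (Set.range c) := c.span_eq ▸ Submodule.mem_top
    refine Submodule.span_mono ?_ hw
    rintro _ ⟨i, rfl⟩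
    exact ⟨b i, (h i).symm⟩
  have hleft : ∀ {u v}, v ∈ J → u * v ∈ J := fun {u v} hv => by
    have := Submodule.mul_mem_mul (hspan u) hv
    rw [hJ, Submodule.span_mul_span] at this
    refine Submodule.span_mono ?_ this
    rintro _ ⟨_, ⟨r, rfl⟩, _, ⟨s, hs, rfl⟩, rfl⟩
    exact ⟨r * s, I.mul_mem_left _ _ hs, map_mul _ _ _⟩
  have hright : ∀ {u v}, u ∈ J → u * v ∈ J := fun {u v} hu => by
    have := Submodule.mul_mem_mul hu (hspan v)
    rw [hJ, Submodule.span_mul_span] at this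
    refine Submodule.span_mono ?_ this
    rintro _ ⟨_, ⟨s, hs, rfl⟩, _, ⟨r, rfl⟩, rfl⟩
    exact ⟨s * r, I.mul_mem_right _ _ hs, map_mul _ _ _⟩
  obtain ⟨s, hs, hs0⟩ : ∃ s ∈ I, s ≠ 0 := by
    by_contra! hall
    exact hbot (eq_bot_iff.2 fun s hs => (TwoSidedIdeal.mem_bot _).2 (hall s hs))
  have h1J : (1 : B) ∈ J := by
    have := IsSimpleRing.one_mem_of_ne_zero_mem (A := B)
      (TwoSidedIdeal.mk' J J.zero_mem J.add_mem J.neg_mem hleft hright) (x := φ s)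
      (by rwa [Ne, map_eq_zero_iff φ hinj])
      ((TwoSidedIdeal.mem_mk' ..).2 (Submodule.subset_span ⟨s, hs, rfl⟩))
    exact (TwoSidedIdeal.mem_mk' ..).1 this
  have hJg : J ≤ LinearMap.ker g := by
    rw [hJ, Submodule.span_le]
    rintro _ ⟨r, hr, rfl⟩
    have : f r = 0 := hfI (TwoSidedIdeal.mem_asIdeal.2 hr)
    change g (φ r) = 0
    rw [hg, this, map_zero]
  have h2 : g 1 = 0 := hJg h1J
  rw [← map_one φ, hg, map_eq_zero] at h2
  exact hf h2

end Descent

instance isSimpleRing_end {L ι : Type*} [Field L] [Fintype ι] [Nonempty ι] :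
    IsSimpleRing (Module.End L (ι → L)) := by
  classical
  let b := Module.Free.chooseBasis L (Module.End L (ι → L))
  exact IsSimpleRing.of_basis (φ := (LinearMap.toMatrixAlgEquiv' : _ ≃ₐ[L] Matrix ι ι L).toAlgHom)
    b (b.map (LinearMap.toMatrixAlgEquiv' : _ ≃ₐ[L] Matrix ι ι L).toLinearEquiv) fun i => rfl

/-! ### Spanning by reduced monomials -/

section Span

variable {R A : Type*} [CommRing R] [Ring A] [Algebra R A] {m n : ℕ}

theorem adjoin_le_span_normalMonomial {x : Fin m → A} {y : Fin n → A}
    (hx : ∀ i j, Commute (x i) (x j)) (hy : ∀ i j, Commute (y i) (y j))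
    {c : (i : Fin m) → (j : Fin n) → MvPolynomial (Fin i ⊕ Fin j) ℤ}
    (hyx : ∀ i j, y j * x i - x i * y j = normalEval (c i j)
      (fun q : Fin i => x (q.castLE i.isLt.le)) (fun r : Fin j => y (r.castLE j.isLt.le)))
    {M N : ℕ} (hM : 0 < M) (hN : 0 < N) {a : Fin m → R} {b : Fin n → R}
    (ha : ∀ i, x i ^ M = algebraMap R A (a i)) (hb : ∀ j, y j ^ N = algebraMap R A (b j)) :
    (Algebra.adjoin R (Set.range x ∪ Set.range y)).toSubmodule ≤
      Submodule.span R (Set.range fun e : (Fin m → Fin M) × (Fin n → Fin N) =>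
        normalMonomial x y (fun q => (e.1 q : ℕ)) fun r => (e.2 r : ℕ)) := by
  refine (adjoin_le_adjoin_mul_adjoin x y fun i j => ?_).trans ((mul_le_mul'
    (adjoin_le_span_prod_ofFn_fin hx hM ha) (adjoin_le_span_prod_ofFn_fin hy hN hb)).trans ?_)
  · rw [hyx, normalEval]
    refine sum_mem fun e _ => ?_
    rw [← zsmul_eq_mul]
    refine zsmul_mem (Submodule.mul_mem_mul ?_ ?_) _
    · exact prod_ofFn_pow_mem (Algebra.adjoin R (Set.range x))
        (fun q => Algebra.subset_adjoin ⟨_, rfl⟩) _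
    · exact prod_ofFn_pow_mem (Algebra.adjoin R (y '' {r | r < j}))
        (fun r => Algebra.subset_adjoin ⟨_, r.isLt, rfl⟩) _
  · rw [Submodule.span_mul_span, Submodule.span_le]
    rintro _ ⟨_, ⟨i, rfl⟩, _, ⟨j, rfl⟩, rfl⟩
    exact Submodule.subset_span ⟨(i, j), rfl⟩

end Span

/-! ### Generators, relations and universal property of the symbol algebra -/

section Symbol

variable {p m n : ℕ} {K : Type*} [Field K] (a : TruncatedWittVector p m K)
  (b : TruncatedWittVector p n K)

theorem commute_symbolX (i j : Fin m) : Commute (symbolX p a b i) (symbolX p a b j) := by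
  have h := congrArg (RingQuot.mkAlgHom K (SymbolRel p a b))
    (RingQuot.mkAlgHom_rel K (BRel.xx (p := p) (R := K) (n := n) i j))
  rw [map_mul (RingQuot.mkAlgHom K (BRel p K m n)), map_mul (RingQuot.mkAlgHom K (BRel p K m n)),
    map_mul, map_mul] at h
  exact h

theorem commute_symbolY (i j : Fin n) : Commute (symbolY p a b i) (symbolY p a b j) := by
  have h := congrArg (RingQuot.mkAlgHom K (SymbolRel p a b))
    (RingQuot.mkAlgHom_rel K (BRel.yy (p := p) (R := K) (m := m) i j))
  rw [map_mul (RingQuot.mkAlgHom K (BRel p K m n)), map_mul (RingQuot.mkAlgHom K (BRel p K m n)),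
    map_mul, map_mul] at h
  exact h

theorem symbolY_mul_symbolX_sub (i : Fin m) (j : Fin n) :
    symbolY p a b j * symbolX p a b i - symbolX p a b i * symbolY p a b j =
      normalEval (commutatorPoly p i j) (fun q : Fin i => symbolX p a b (q.castLE i.isLt.le))
        (fun r : Fin j => symbolY p a b (r.castLE j.isLt.le)) := by
  let φ : FreeAlgebra K (Fin m ⊕ Fin n) →+* SymbolAlg p a b :=
    ((RingQuot.mkAlgHom K (SymbolRel p a b)).comp (RingQuot.mkAlgHom K (BRel p K m n))).toRingHom
  have h : φ _ = φ _ := congrArg (RingQuot.mkAlgHom K (SymbolRel p a b))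
    (RingQuot.mkAlgHom_rel K (BRel.yx (p := p) (R := K) i j))
  rw [map_sub, map_mul, map_mul] at h
  exact h.trans (map_normalEval (A := FreeAlgebra K (Fin m ⊕ Fin n)) (B := SymbolAlg p a b) φ
    (commutatorPoly p i j) _ _)

theorem symbolX_pow (i : Fin m) :
    symbolX p a b i ^ p ^ n = algebraMap K _ (TruncatedWittVector.coeff i a) := by
  have h := RingQuot.mkAlgHom_rel K (SymbolRel.x (a := a) (b := b) i)
  rwa [map_pow, AlgHom.commutes] at h

theorem symbolY_pow (j : Fin n) :
    symbolY p a b j ^ p ^ m = algebraMap K _ (TruncatedWittVector.coeff j b) := by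
  have h := RingQuot.mkAlgHom_rel K (SymbolRel.y (a := a) (b := b) j)
  rwa [map_pow, AlgHom.commutes] at h

theorem adjoin_symbol_eq_top :
    Algebra.adjoin K (Set.range (symbolX p a b) ∪ Set.range (symbolY p a b)) = ⊤ := by
  have h := congrArg (Subalgebra.map (RingQuot.mkAlgHom K (SymbolRel p a b)))
    (mkAlgHom_adjoin_eq_top (BRel p K m n))
  rw [Algebra.map_top, (AlgHom.range_eq_top _).2 (RingQuot.mkAlgHom_surjective K _),
    AlgHom.map_adjoin, Set.image_union, ← Set.range_comp, ← Set.range_comp] at h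
  exact h

theorem exists_symbolAlg_lift {B : Type*} [Ring B] [Algebra K B] {x : Fin m → B} {y : Fin n → B}
    (hx : ∀ i j, Commute (x i) (x j)) (hy : ∀ i j, Commute (y i) (y j))
    (hyx : ∀ i j, y j * x i - x i * y j = normalEval (commutatorPoly p i j)
      (fun q : Fin i => x (q.castLE i.isLt.le)) (fun r : Fin j => y (r.castLE j.isLt.le)))
    (ha : ∀ i, x i ^ p ^ n = algebraMap K B (TruncatedWittVector.coeff i a))
    (hb : ∀ j, y j ^ p ^ m = algebraMap K B (TruncatedWittVector.coeff j b)) :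
    ∃ φ : SymbolAlg p a b →ₐ[K] B,
      (∀ i, φ (symbolX p a b i) = x i) ∧ ∀ j, φ (symbolY p a b j) = y j := by
  let f : FreeAlgebra K (Fin m ⊕ Fin n) →ₐ[K] B := FreeAlgebra.lift K (Sum.elim x y)
  have hfx : ∀ i, f (freeX K m n i) = x i := fun i => FreeAlgebra.lift_ι_apply _ _
  have hfy : ∀ j, f (freeY K m n j) = y j := fun j => FreeAlgebra.lift_ι_apply _ _
  have hf : ∀ ⦃u v⦄, BRel p K m n u v → f u = f v := by
    intro u v h
    cases h with
    | xx i j => rw [map_mul, map_mul, hfx, hfx]; exact hx i j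
    | yy i j => rw [map_mul, map_mul, hfy, hfy]; exact hy i j
    | yx i j =>
      refine Eq.trans ?_ (map_normalEval f.toRingHom _ _ _).symm
      rw [map_sub, map_mul, map_mul, hfx, hfy, hyx]
      congr 1
      · exact funext fun q => (hfx _).symm
      · exact funext fun r => (hfy _).symm
  let g : BAlg p K m n →ₐ[K] B := RingQuot.liftAlgHom K ⟨f, hf⟩
  have hgx : ∀ i, g (bX p K m n i) = x i := fun i =>
    (RingQuot.liftAlgHom_mkAlgHom_apply K f hf _).trans (hfx i)
  have hgy : ∀ j, g (bY p K m n j) = y j := fun j =>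
    (RingQuot.liftAlgHom_mkAlgHom_apply K f hf _).trans (hfy j)
  have hg : ∀ ⦃u v⦄, SymbolRel p a b u v → g u = g v := by
    intro u v h
    cases h with
    | x i => rw [map_pow, hgx, AlgHom.commutes, ha]
    | y j => rw [map_pow, hgy, AlgHom.commutes, hb]
  exact ⟨RingQuot.liftAlgHom K ⟨g, hg⟩,
    fun i => (RingQuot.liftAlgHom_mkAlgHom_apply K g hg _).trans (hgx i),
    fun j => (RingQuot.liftAlgHom_mkAlgHom_apply K g hg _).trans (hgy j)⟩

end Symbol

/-- The images of the monomials span a space whose dimension is their number, so they are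
independent over `L`, and the monomials are independent over `K`. The two resulting bases correspond
under `φ`, as the descent lemmas require. -/
theorem isCentral_isSimpleRing_of_generators {p m n : ℕ} [Fact p.Prime] {K A : Type*} [Field K]
    [Ring A] [Algebra K A] {a : Fin m → K} {b : Fin n → K} {x : Fin m → A}
    {y : Fin n → A} (hx : ∀ i j, Commute (x i) (x j)) (hy : ∀ i j, Commute (y i) (y j))
    (hyx : ∀ i j, y j * x i - x i * y j = normalEval (commutatorPoly p i j)
      (fun q : Fin i => x (q.castLE i.isLt.le)) (fun r : Fin j => y (r.castLE j.isLt.le)))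
    (hxa : ∀ i, x i ^ p ^ n = algebraMap K A (a i))
    (hyb : ∀ j, y j ^ p ^ m = algebraMap K A (b j))
    (htop : Algebra.adjoin K (Set.range x ∪ Set.range y) = ⊤)
    {L : Type*} [Field L] [Algebra K L]
    {x' : Fin m → Module.End L ((Fin m → Fin (p ^ n)) → L)}
    {y' : Fin n → Module.End L ((Fin m → Fin (p ^ n)) → L)}
    (hspan : ⊤ ≤ Submodule.span L (Set.range fun e : (Fin m → Fin (p ^ n)) × (Fin n → Fin (p ^ m)) =>
      normalMonomial x' y' (fun q => (e.1 q : ℕ)) fun r => (e.2 r : ℕ)))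
    {φ : A →ₐ[K] Module.End L ((Fin m → Fin (p ^ n)) → L)}
    (hφx : ∀ i, φ (x i) = x' i) (hφy : ∀ j, φ (y j) = y' j) :
    Algebra.IsCentral K A ∧ IsSimpleRing A ∧ Module.Finite K A ∧
    Module.finrank K A = (p ^ (m * n)) ^ 2 ∧
    ∃ B : Module.Basis ((Fin m → Fin (p ^ n)) × (Fin n → Fin (p ^ m))) K A,
      ∀ e, B e = normalMonomial x y (fun q => (e.1 q : ℕ)) (fun r => (e.2 r : ℕ)) := by
  have hp : 0 < p := (Fact.out : p.Prime).pos
  let u : (Fin m → Fin (p ^ n)) × (Fin n → Fin (p ^ m)) → A := fun e =>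
    normalMonomial x y (fun q => (e.1 q : ℕ)) fun r => (e.2 r : ℕ)
  have hφu : (fun e : (Fin m → Fin (p ^ n)) × (Fin n → Fin (p ^ m)) =>
      normalMonomial x' y' (fun q => (e.1 q : ℕ)) fun r => (e.2 r : ℕ)) = fun e => φ (u e) := by
    ext1 e
    refine Eq.trans ?_ (map_normalMonomial (B := Module.End L ((Fin m → Fin (p ^ n)) → L))
      φ.toRingHom x y _ _).symm
    congr 1
    · exact funext fun i => (hφx i).symm
    · exact funext fun i => (hφy i).symm
  rw [hφu] at hspan
  have hspanK : ⊤ ≤ Submodule.span K (Set.range u) := by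
    rw [← Algebra.top_toSubmodule, ← htop]
    exact adjoin_le_span_normalMonomial hx hy hyx (pow_pos hp n) (pow_pos hp m) hxa hyb
  have hcard : Fintype.card ((Fin m → Fin (p ^ n)) × (Fin n → Fin (p ^ m))) =
      (p ^ (m * n)) ^ 2 := by
    simp only [Fintype.card_prod, Fintype.card_fun, Fintype.card_fin]
    ring
  have hdim : Fintype.card ((Fin m → Fin (p ^ n)) × (Fin n → Fin (p ^ m))) =
      Module.finrank L (Module.End L ((Fin m → Fin (p ^ n)) → L)) := by
    rw [hcard, Module.finrank_linearMap, Module.finrank_fintype_fun_eq_card]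
    simp only [Fintype.card_fun, Fintype.card_fin]
    ring
  have hind : LinearIndependent L fun e => φ (u e) :=
    linearIndependent_of_top_le_span_of_card_eq_finrank hspan hdim
  let B : Module.Basis _ K A := Module.Basis.mk (linearIndependent_of_map hind) hspanK
  let C : Module.Basis _ L (Module.End L ((Fin m → Fin (p ^ n)) → L)) :=
    Module.Basis.mk hind hspan
  have hB : ∀ e, B e = u e := fun e => Module.Basis.mk_apply _ _ e
  have hC : ∀ e, C e = φ (B e) := fun e => by rw [hB]; exact Module.Basis.mk_apply _ _ e
  have : Nonempty (Fin m → Fin (p ^ n)) := ⟨fun _ => ⟨0, pow_pos hp n⟩⟩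
  exact ⟨Algebra.IsCentral.of_basis B C hC, IsSimpleRing.of_basis B C hC, .of_basis B,
    by rw [Module.finrank_eq_card_basis B, hcard], B, hB⟩

theorem theorem4p5 (p : ℕ) [Fact p.Prime] {K : Type*} [Field K] [CharP K p] (m n : ℕ)
    (a : TruncatedWittVector p m K) (b : TruncatedWittVector p n K) :
    Algebra.IsCentral K (SymbolAlg p a b) ∧
    IsSimpleRing (SymbolAlg p a b) ∧
    Module.Finite K (SymbolAlg p a b) ∧
    Module.finrank K (SymbolAlg p a b) = (p ^ (m * n)) ^ 2 ∧
    ∃ B : Module.Basis ((Fin m → Fin (p ^ n)) × (Fin n → Fin (p ^ m))) K (SymbolAlg p a b),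
      ∀ e, B e = normalMonomial (symbolX p a b) (symbolY p a b)
        (fun q => (e.1 q : ℕ)) (fun r => (e.2 r : ℕ)) := by
  have hp : 0 < p := (Fact.out : p.Prime).pos
  have hM : 0 < p ^ n := pow_pos hp n
  have hN : 0 < p ^ m := pow_pos hp m
  let L := AlgebraicClosure K
  have : CharP L p := charP_of_injective_algebraMap (algebraMap K L).injective p
  -- Over `L` the entries of `a` are `p^n`-th powers and those of `b` are `p^m`-th powers, so the
  -- truncated representation applies.
  choose α hα using fun i => IsAlgClosed.exists_pow_nat_eq
    (algebraMap K L (TruncatedWittVector.coeff i a)) hM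
  choose β hβ using fun j => IsAlgClosed.exists_pow_nat_eq
    (algebraMap K L (TruncatedWittVector.coeff j b)) hN
  obtain ⟨x, y, hx, hy, hyx, hxp, hyp, htop⟩ := exists_end_generators p m n α β
  obtain ⟨φ, hφx, hφy⟩ := exists_symbolAlg_lift a b hx hy hyx
    (fun i => by rw [hxp, hα, ← IsScalarTower.algebraMap_apply])
    (fun j => by rw [hyp, hβ, ← IsScalarTower.algebraMap_apply])
  refine isCentral_isSimpleRing_of_generators (A := SymbolAlg p a b) (commute_symbolX a b)
    (commute_symbolY a b) (symbolY_mul_symbolX_sub a b) (symbolX_pow a b) (symbolY_pow a b)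
    (adjoin_symbol_eq_top a b) ?_ hφx hφy
  rw [← Algebra.top_toSubmodule, ← htop]
  exact adjoin_le_span_normalMonomial hx hy hyx hM hN hxp hyp
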